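/- **Theorem 3.2.** Let $f:\mathbb R\to\mathbb C$ be $2\pi$-periodic and piecewise analytic: there are points $0=t_0<t_1<\dots<t_n=2\pi$ such that on each $(t_i,t_{i+1})$, $f$ is the restriction of a function that is real analytic on a neighbourhood of $[t_i,t_{i+1}]$ (the values $f(t_i)$ are arbitrary). Let $\operatorname{sing\,supp} f$ be the complement of the largest open set on which $f$ is $C^\infty$, and put $$d(x)=\operatorname{dist}(x,\operatorname{sing\,supp}f)\quad(\text{and } d(x)=\pi \text{ if } \operatorname{sing\,supp}f=\emptyset),\qquad \theta(x)=\frac{d(x)}{\pi}.$$ For $c>0$, $p\in\mathbb N=\{0,1,2,\dots\}$, $\theta>0$ let $$\psi_{p,\theta}(y)=\frac1\theta\,\rho_c\!\Big(\frac y\theta\Big)D_p\!\Big(\frac y\theta\Big),\qquad \rho_c(y)=\begin{cases}e^{cy^2/(y^2-\pi^2)},&|y|<\pi,\\0,&|y|\ge\pi,\end{cases}\qquad D_p(y)=\frac1{2\pi}\sum_{|k|\le p}e^{iky}.$$ Let $y_\nu=\frac{\pi}{N}\nu$, $0\le\nu\le 2N-1$, be the equidistant grid points. Say that $f$ has local analyticity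 constants $(M,r)$ at $x$, where $M,r>0$, if $|f^{(k)}(y)|\le M\,k!/r^k$ for all $k\ge0$ and all $y$ with $|y-x|<d(x)$. Every $f$ as above admits $M,r>0$ that serve at all $x\in\mathbb R$ simultaneously. Fix $c>0$, $\beta_0>1$, $\delta>0$ and a nondecreasing function $\omega:\mathbb R\to\mathbb R$ with $\omega(t)=o(t)$ as $t\to\infty$. Then for all $M,r>0$ there are constants $C>0$ and $\eta>0$, depending only on $(c,\beta_0,\delta,\omega)$ and on $(M,r)$, such that the following holds for every $f$ as above and every $x$ at which $f$ has local analyticity constants $(M,r)$. For every $\beta$ with $$\beta_0\le\beta<1.764,\qquad \kappa:=\beta\log\beta<1,$$ every $N\in\mathbb N$ with $d(x)N\ge\delta$, and every degree $p\in\mathbb N$ with $p\sim\kappa\,\theta(x)N$ in the sense that $|p-\kappa\,\theta(x)N|\le\omega(\theta(x)N)$, $$\Big|\frac{\pi}{N}\sum_{\nu=0}^{2N-1}\psi_{p,\theta(x)}(x-y_\nu)\,f(y_\nu)-f(x)\Big|\le C\,(d(x)N)^2\Big(\frac{\beta}{e}\Big)^{2\sqrt{\beta\,\eta\,\theta(x)N}},$$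 where $x-y_\nu$ is taken modulo $2\pi$, in $(-\pi,\pi]$. -/

import Mathlib

open Real Set Filter Topology Asymptotics

noncomputable section

namespace AdaptiveMollifier

/-- `f` is `2π`-periodic and piecewise analytic: a period is cut by finitely many points
`0 = t 0 < t 1 < ⋯ < t n = 2π` so that on every open piece `f` is the restriction of a function
that is real analytic on a neighbourhood of the closed piece. The values of `f` at the points `t i`
are arbitrary. -/
def IsPeriodicPiecewiseAnalytic (f : ℝ → ℂ) : Prop :=
  Function.Periodic f (2 * π) ∧
    ∃ (n : ℕ) (t : ℕ → ℝ), t 0 = 0 ∧ t n = 2 * π ∧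
      ∀ i < n, t i < t (i + 1) ∧
        ∃ g : ℝ → ℂ, AnalyticOnNhd ℝ g (Icc (t i) (t (i + 1))) ∧
          EqOn f g (Ioo (t i) (t (i + 1)))

open scoped ContDiff in
/-- The singular support of a function on the line: the complement of the largest open set on
which the function is smooth. -/
def singSupp (f : ℝ → ℂ) : Set ℝ :=
  {x | ¬ ∀ᶠ y in 𝓝 x, ContDiffAt ℝ ∞ f y}

open Classical in
/-- The distance `d(x)` from `x` to the singular support of `f`. For a `2π`-periodic function with
a singularity this is at most `π`; if there is no singularity the value is `π`, the largest
admissible half-width of the window. -/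
def edgeDist (f : ℝ → ℂ) (x : ℝ) : ℝ :=
  if singSupp f = ∅ then π else Metric.infDist x (singSupp f)

/-- The dilation parameter `θ(x) = d(x) / π`. -/
def theta (f : ℝ → ℂ) (x : ℝ) : ℝ := edgeDist f x / π

/-- The localizer `ρ_c(y) = exp (c y² / (y² - π²))` for `|y| < π`, extended by zero. -/
def rho (c y : ℝ) : ℝ :=
  if |y| < π then Real.exp (c * y ^ 2 / (y ^ 2 - π ^ 2)) else 0

/-- The Dirichlet kernel `D_p(y) = (1 / 2π) ∑_{|k| ≤ p} e^{iky}`. -/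
def dirichlet (p : ℕ) (y : ℝ) : ℂ :=
  1 / (2 * π) * ∑ k ∈ Finset.Icc (-(p : ℤ)) (p : ℤ), Complex.exp ((k : ℂ) * y * Complex.I)

/-- The two-parameter mollifier `ψ_{p,θ}(y) = (1/θ) ρ_c(y/θ) D_p(y/θ)`. -/
def psi (c : ℝ) (p : ℕ) (θ y : ℝ) : ℂ :=
  1 / θ * rho c (y / θ) * dirichlet p (y / θ)

/-- The equidistant grid points `y_ν = πν/N`. -/
def gridPt (N ν : ℕ) : ℝ := π / N * ν

/-- The discrete convolution `(π/N) ∑_{ν=0}^{2N-1} ψ_{p,θ}(x - y_ν) f(y_ν)` on the circle: the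
difference `x - y_ν` is taken modulo `2π`, with representative in `(-π, π]`. -/
def discreteConv (c : ℝ) (p : ℕ) (θ : ℝ) (N : ℕ) (f : ℝ → ℂ) (x : ℝ) : ℂ :=
  π / N * ∑ ν ∈ Finset.range (2 * N),
    psi c p θ (toIocMod Real.two_pi_pos (-π) (x - gridPt N ν)) * f (gridPt N ν)

/-- The analytic behaviour of `f` in the window `|y - x| < d(x)`: the derivatives satisfy
`|f⁽ᵏ⁾(y)| ≤ M k! / r ^ k` there. -/
def LocalAnalyticBound (f : ℝ → ℂ) (x M r : ℝ) : Prop :=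
  ∀ y : ℝ, |y - x| < edgeDist f x → ∀ k : ℕ,
    ‖iteratedDeriv k f y‖ ≤ M * (Nat.factorial k : ℝ) / r ^ k

end AdaptiveMollifier

end

open scoped FourierTransform

namespace AdaptiveMollifier

/-! Rescale the window to `|u| < π` and put `F u = rho c u * f (x - θ u)` (`localized`). The
localizer extends holomorphically off `±π` and decays like `exp(-const/(π - |u|))` at the ends.
Cauchy's estimate then costs `k!` and a power of the distance to the ends, and paying that power
with the exponential costs a second `k!`. Since `f` is analytic in the window and `θ ≤ 1`, `F` is
smooth, compactly supported and of Gevrey order 2 with constants depending on `c`, `M`, `r` only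
(`localized_gevrey`). Hence its Fourier transform is `O(exp(-a√|t|)/t²)` at angular frequency `t`
(`exists_fourier_decay`).

The discrete convolution is a Riemann sum of `F * dirichlet p` over a lattice of step `π/X`, with `X
= θ N` (`discreteConv_eq_tsum`). Poisson summation turns each frequency `|k| ≤ p` into its Fourier
coefficient plus aliases at distance at least `2X - p`, while `2π F 0 = 2π f x` is the full sum of
the coefficients. The error is thus aliasing, of size `exp(-a√(2X - p))`, plus truncation, of size
`exp(-a√p)` (`norm_tsum_sub_le_of_fourier_decay`).

For large `X`, both `p` and `2X - p` exceed a fixed multiple of `X`, so the error is `O(exp(-b√X))`;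
a small `η` puts this below the stated power of `β/e`. For bounded `X` a crude bound suffices,
because `d(x) N ≥ δ`. -/

/-! ### Uniform analyticity constants -/

/-- Re-expand the power series at each `y` within `ρ/2` of `x`. All the new coefficients are
dominated by one series, summable because `ρ/2 + ρ/2` is below the radius of convergence. -/
lemma exists_iteratedDeriv_bound_nhds {g : ℝ → ℂ} {x : ℝ} (hg : AnalyticAt ℝ g x) :
    ∃ M r : ℝ, 0 < M ∧ 0 < r ∧ ∀ᶠ y in 𝓝 x, ∀ k : ℕ,
      ‖iteratedDeriv k g y‖ ≤ M * (Nat.factorial k : ℝ) / r ^ k := by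
  obtain ⟨p, R, hp⟩ := hg
  obtain ⟨ρ, hρ0, hρ⟩ := ENNReal.lt_iff_exists_nnreal_btwn.1 hp.r_pos
  have hρ0' : 0 < ρ := by exact_mod_cast hρ0
  have h2 : ((ρ / 2 : NNReal) + (ρ / 2 : NNReal) : ENNReal) < p.radius := by
    rw [← ENNReal.coe_add, add_halves]
    exact hρ.trans_le hp.r_le
  have hs := p.changeOriginSeries_summable_aux₁ h2
  have hr2 : (0 : NNReal) < ρ / 2 := by positivity
  set T := ∑' s : (Σ k l : ℕ, { s : Finset (Fin (k + l)) // s.card = l }),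
      ‖p (s.1 + s.2.1)‖₊ * (ρ / 2) ^ s.2.1 * (ρ / 2) ^ s.1 with hT
  refine ⟨T + 1, (ρ / 2 : NNReal), by positivity, by exact_mod_cast hr2, ?_⟩
  filter_upwards [Metric.ball_mem_nhds x (show (0 : ℝ) < (ρ / 2 : NNReal) by exact_mod_cast hr2)]
    with y hy k
  set z := y - x with hz
  have hzn : ‖z‖₊ ≤ ρ / 2 := by
    rw [← NNReal.coe_le_coe]
    simpa [hz, dist_eq_norm] using (Metric.mem_ball.1 hy).le
  have hzR : (‖z‖₊ : ENNReal) < R := by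
    refine lt_of_le_of_lt ?_ hρ
    exact_mod_cast hzn.trans (half_le_self ρ.2)
  have hco := hp.changeOrigin hzR
  rw [show x + z = y by simp [hz]] at hco
  have hk : ‖p.changeOrigin z k‖₊ * (ρ / 2) ^ k ≤ T := by
    have h1 := p.nnnorm_changeOrigin_le k (hzR.trans_le hp.r_le)
    have hsk := (NNReal.summable_sigma.1 hs).1 k
    calc ‖p.changeOrigin z k‖₊ * (ρ / 2) ^ k
        ≤ (∑' s : Σ l : ℕ, { s : Finset (Fin (k + l)) // s.card = l },
            ‖p (k + s.1)‖₊ * ‖z‖₊ ^ s.1) * (ρ / 2) ^ k := by gcongr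
      _ = ∑' s : Σ l : ℕ, { s : Finset (Fin (k + l)) // s.card = l },
            ‖p (k + s.1)‖₊ * ‖z‖₊ ^ s.1 * (ρ / 2) ^ k := (NNReal.tsum_mul_right _ _).symm
      _ ≤ ∑' s : Σ l : ℕ, { s : Finset (Fin (k + l)) // s.card = l },
            ‖p (k + s.1)‖₊ * (ρ / 2) ^ s.1 * (ρ / 2) ^ k := by
          refine Summable.tsum_le_tsum (fun s => by gcongr) ?_ hsk
          exact NNReal.summable_of_le (fun s => by gcongr) hsk
      _ ≤ T := NNReal.tsum_comp_le_tsum_of_inj hs (i := Sigma.mk k) sigma_mk_injective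
  have hk' : ‖p.changeOrigin z k‖ * (ρ / 2 : NNReal) ^ k ≤ (T : ℝ) := by exact_mod_cast hk
  rw [iteratedDeriv_eq_iteratedFDeriv, ← hco.factorial_smul, nsmul_eq_mul, norm_mul,
    le_div_iff₀ (by positivity)]
  have h3 : ‖p.changeOrigin z k fun _ => (1 : ℝ)‖ ≤ ‖p.changeOrigin z k‖ := by
    simpa only [norm_one, Finset.prod_const_one, mul_one] using
      (p.changeOrigin z k).le_opNorm (fun _ => (1 : ℝ))
  rw [Complex.norm_natCast]
  calc (k.factorial : ℝ) * ‖p.changeOrigin z k fun _ => (1 : ℝ)‖ * (ρ / 2 : NNReal) ^ k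
      ≤ k.factorial * (‖p.changeOrigin z k‖ * (ρ / 2 : NNReal) ^ k) := by
        rw [mul_assoc]; gcongr
    _ ≤ k.factorial * T := by gcongr
    _ ≤ (T + 1) * k.factorial := by nlinarith [show (0 : ℝ) ≤ k.factorial by positivity]

lemma factorial_bound_mono {M M' r r' : ℝ} (hM : 0 ≤ M) (hMM' : M ≤ M') (hr' : 0 < r')
    (hrr' : r' ≤ r) (k : ℕ) :
    M * (Nat.factorial k : ℝ) / r ^ k ≤ M' * (Nat.factorial k : ℝ) / r' ^ k := by
  have := hM.trans hMM'
  gcongr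

lemma exists_iteratedDeriv_bound_of_isCompact {g : ℝ → ℂ} {s : Set ℝ} (hs : IsCompact s)
    (hg : AnalyticOnNhd ℝ g s) :
    ∃ M r : ℝ, 0 < M ∧ 0 < r ∧ ∀ y ∈ s, ∀ k : ℕ,
      ‖iteratedDeriv k g y‖ ≤ M * (Nat.factorial k : ℝ) / r ^ k := by
  refine hs.induction_on (p := fun s => ∃ M r : ℝ, 0 < M ∧ 0 < r ∧ ∀ y ∈ s, ∀ k : ℕ,
      ‖iteratedDeriv k g y‖ ≤ M * (Nat.factorial k : ℝ) / r ^ k) ?_ ?_ ?_ ?_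
  · exact ⟨1, 1, one_pos, one_pos, by simp⟩
  · rintro s t hst ⟨M, r, hM, hr, h⟩
    exact ⟨M, r, hM, hr, fun y hy => h y (hst hy)⟩
  · rintro s t ⟨M, r, hM, hr, h⟩ ⟨M', r', hM', hr', h'⟩
    refine ⟨max M M', min r r', by positivity, by positivity, ?_⟩
    rintro y (hy | hy) k
    · exact (h y hy k).trans (factorial_bound_mono hM.le (le_max_left _ _) (by positivity)
        (min_le_left _ _) k)
    · exact (h' y hy k).trans (factorial_bound_mono hM'.le (le_max_right _ _) (by positivity)
        (min_le_right _ _) k)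
  · intro x hx
    obtain ⟨M, r, hM, hr, h⟩ := exists_iteratedDeriv_bound_nhds (hg x hx)
    exact ⟨_, mem_nhdsWithin_of_mem_nhds h, M, r, hM, hr, fun y hy => hy⟩

lemma exists_piece {t : ℕ → ℝ} {n : ℕ} {y : ℝ} (h0 : t 0 ≤ y) (hn : y < t n) :
    ∃ i < n, t i ≤ y ∧ y < t (i + 1) := by
  induction n with
  | zero => exact absurd hn (not_lt.2 h0)
  | succ n ih =>
    rcases lt_or_ge y (t n) with h | h
    · obtain ⟨i, hi, h'⟩ := ih h
      exact ⟨i, by omega, h'⟩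
    · exact ⟨n, by omega, h, hn⟩

lemma periodic_iteratedDeriv {f : ℝ → ℂ} {T : ℝ} (hf : Function.Periodic f T) (k : ℕ) :
    Function.Periodic (iteratedDeriv k f) T := by
  intro y
  have h := congrFun (iteratedDeriv_comp_add_const k f T) y
  rw [← h]
  exact congrFun (congrArg (iteratedDeriv k) (funext hf)) y

/-- One-sided because a breakpoint, where the value of `f` is arbitrary, still has a right
neighbourhood inside a single translated piece. -/
lemma exists_bound_right_nhds {f : ℝ → ℂ} (hf : IsPeriodicPiecewiseAnalytic f) :
    ∃ M r : ℝ, 0 < M ∧ 0 < r ∧ ∀ y : ℝ, ∀ᶠ z in 𝓝[>] y, ∀ k : ℕ,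
      ‖iteratedDeriv k f z‖ ≤ M * (Nat.factorial k : ℝ) / r ^ k := by
  obtain ⟨hper, n, t, h0, hn, hpc⟩ := hf
  have hfin : ∀ m ≤ n, ∃ M r : ℝ, 0 < M ∧ 0 < r ∧ ∀ i < m, ∀ y ∈ Ioo (t i) (t (i + 1)),
      ∀ k : ℕ, ‖iteratedDeriv k f y‖ ≤ M * (Nat.factorial k : ℝ) / r ^ k := by
    intro m
    induction m with
    | zero => exact fun _ => ⟨1, 1, one_pos, one_pos, by simp⟩
    | succ m ih =>
      intro hm
      obtain ⟨M, r, hM, hr, h⟩ := ih (by omega)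
      obtain ⟨-, g, hg, hfg⟩ := hpc m (by omega)
      obtain ⟨M', r', hM', hr', h'⟩ := exists_iteratedDeriv_bound_of_isCompact isCompact_Icc hg
      refine ⟨max M M', min r r', by positivity, by positivity, ?_⟩
      intro i hi y hy k
      rcases Nat.lt_succ_iff_lt_or_eq.1 hi with hi | rfl
      · exact (h i hi y hy k).trans (factorial_bound_mono hM.le (le_max_left _ _) (by positivity)
          (min_le_left _ _) k)
      · rw [Filter.EventuallyEq.iteratedDeriv_eq k
          (Filter.eventuallyEq_of_mem (isOpen_Ioo.mem_nhds hy) hfg)]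
        exact (h' y (Ioo_subset_Icc_self hy) k).trans (factorial_bound_mono hM'.le
          (le_max_right _ _) (by positivity) (min_le_right _ _) k)
  obtain ⟨M, r, hM, hr, h⟩ := hfin n le_rfl
  refine ⟨M, r, hM, hr, fun y => ?_⟩
  set y₀ := toIcoMod Real.two_pi_pos 0 y with hy₀
  have hmem := toIcoMod_mem_Ico Real.two_pi_pos 0 y
  obtain ⟨i, hi, hi1, hi2⟩ := exists_piece (t := t) (n := n) (y := y₀)
    (by rw [h0]; exact hmem.1) (by rw [hn]; simpa using hmem.2)
  set q := toIcoDiv Real.two_pi_pos 0 y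
  have hyq : y = y₀ + q * (2 * π) := by
    have := toIcoMod_add_toIcoDiv_zsmul Real.two_pi_pos 0 y
    rw [zsmul_eq_mul] at this
    exact this.symm
  have hlt : y < t (i + 1) + q * (2 * π) := by rw [hyq]; linarith
  filter_upwards [Ioo_mem_nhdsGT hlt] with z hz k
  have hz' : z - q * (2 * π) ∈ Ioo (t i) (t (i + 1)) := by
    constructor <;> linarith [hz.1, hz.2]
  have hper' := (periodic_iteratedDeriv hper k).sub_int_mul_eq q (x := z)
  rw [← hper']
  exact h i hi _ hz' k

lemma contDiffAt_of_abs_sub_lt {f : ℝ → ℂ} {x y : ℝ} (h : |y - x| < edgeDist f x) :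
    ∀ᶠ z in 𝓝 y, ContDiffAt ℝ (⊤ : ℕ∞) f z := by
  by_contra hy
  have hy : y ∈ singSupp f := hy
  have hne : singSupp f ≠ ∅ := fun h0 => by simp [h0] at hy
  rw [edgeDist, if_neg hne] at h
  have := Metric.infDist_le_dist_of_mem (x := x) hy
  rw [dist_comm, Real.dist_eq] at this
  linarith

lemma contDiffAt_iteratedDeriv {f : ℝ → ℂ} {y : ℝ} (hf : ContDiffAt ℝ (⊤ : ℕ∞) f y) (k : ℕ) :
    ContDiffAt ℝ (⊤ : ℕ∞) (iteratedDeriv k f) y := by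
  have h := hf.iteratedFDeriv_right (m := (⊤ : ℕ∞)) (i := k) (mod_cast le_top)
  exact (ContinuousMultilinearMap.apply ℝ (fun _ : Fin k => ℝ) ℂ
    (fun _ => 1)).contDiff.contDiffAt.comp y h

theorem exists_localAnalyticBound {f : ℝ → ℂ} (hf : IsPeriodicPiecewiseAnalytic f) :
    ∃ M r : ℝ, 0 < M ∧ 0 < r ∧ ∀ x : ℝ, LocalAnalyticBound f x M r := by
  obtain ⟨M, r, hM, hr, h⟩ := exists_bound_right_nhds hf
  refine ⟨M, r, hM, hr, fun x y hy k => ?_⟩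
  have hc : ContDiffAt ℝ (⊤ : ℕ∞) f y := (contDiffAt_of_abs_sub_lt hy).self_of_nhds
  have hcont : ContinuousAt (iteratedDeriv k f) y := (contDiffAt_iteratedDeriv hc k).continuousAt
  -- The window may contain a breakpoint at which `f` happens to be smooth; continuity of the
  -- derivatives carries the bound there from the right.
  refine le_of_tendsto (f := fun z => ‖iteratedDeriv k f z‖)
    (hcont.norm.tendsto.mono_left nhdsWithin_le_nhds) ?_ (x := 𝓝[>] y)
  filter_upwards [h y] with z hz using hz k

/-! ### The edge distance of a periodic function -/

lemma singSupp_add_int {f : ℝ → ℂ} (hf : Function.Periodic f (2 * π)) {s : ℝ}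
    (hs : s ∈ singSupp f) (q : ℤ) : s + q * (2 * π) ∈ singSupp f := by
  intro h
  apply hs
  have hsh : f = fun z => f (z + q * (2 * π)) := funext fun z => (hf.int_mul q z).symm
  have ht : Tendsto (fun z : ℝ => z + q * (2 * π)) (𝓝 s) (𝓝 (s + q * (2 * π))) :=
    (continuous_id.add continuous_const).tendsto s
  filter_upwards [ht.eventually h] with z hz
  rw [hsh]
  exact ContDiffAt.comp (f := fun z : ℝ => z + q * (2 * π)) z hz (by fun_prop)

lemma edgeDist_nonneg (f : ℝ → ℂ) (x : ℝ) : 0 ≤ edgeDist f x := by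
  unfold edgeDist
  split_ifs
  · exact Real.pi_pos.le
  · exact Metric.infDist_nonneg

lemma edgeDist_le_pi {f : ℝ → ℂ} (hf : Function.Periodic f (2 * π)) (x : ℝ) :
    edgeDist f x ≤ π := by
  unfold edgeDist
  split_ifs with h
  · exact le_rfl
  · obtain ⟨s, hs⟩ := nonempty_iff_ne_empty.2 h
    have h1 := toIcoMod_mem_Ico Real.two_pi_pos (x - π) s
    have h2 := toIcoMod_add_toIcoDiv_zsmul Real.two_pi_pos (x - π) s
    set s' := toIcoMod Real.two_pi_pos (x - π) s
    set q := toIcoDiv Real.two_pi_pos (x - π) s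
    rw [zsmul_eq_mul] at h2
    have hs' : s' ∈ singSupp f := by
      have := singSupp_add_int hf hs (-q)
      rwa [← h2, Int.cast_neg, neg_mul, add_neg_cancel_right] at this
    refine (Metric.infDist_le_dist_of_mem hs').trans ?_
    rw [Real.dist_eq, abs_le]
    constructor <;> linarith [h1.1, h1.2]

/-! ### Derivative bounds for the localizer -/

/-- The localizer as a function of a complex variable, analytic away from `±π`. -/
noncomputable def rhoComplex (c : ℝ) (z : ℂ) : ℂ :=
  Complex.exp (c * z ^ 2 / (z ^ 2 - π ^ 2))

lemma rho_eq_rhoComplex (c : ℝ) {y : ℝ} (hy : |y| < π) : (rho c y : ℂ) = rhoComplex c y := by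
  simp [rho, rhoComplex, hy]

lemma iteratedDeriv_comp_ofReal {R : ℂ → ℂ} {U : Set ℂ} (hU : IsOpen U)
    (hR : DifferentiableOn ℂ R U) (k : ℕ) (y : ℝ) (hy : (y : ℂ) ∈ U) :
    iteratedDeriv k (fun u : ℝ => R u) y = iteratedDeriv k R y := by
  induction k generalizing y with
  | zero => simp
  | succ k ih =>
    have hev : iteratedDeriv k (fun u : ℝ => R u) =ᶠ[𝓝 y] fun u : ℝ => iteratedDeriv k R u := by
      filter_upwards [(Complex.continuous_ofReal.isOpen_preimage U hU).mem_nhds hy] with u hu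
        using ih u hu
    have han : AnalyticAt ℂ (iteratedDeriv k R) y := by
      rw [iteratedDeriv_eq_iterate]
      exact (hR.analyticAt (hU.mem_nhds hy)).iterated_deriv k
    rw [iteratedDeriv_succ, hev.deriv_eq, iteratedDeriv_succ]
    exact han.differentiableAt.hasDerivAt.comp_ofReal.deriv

lemma differentiableAt_rhoComplex (c : ℝ) {z : ℂ} (h1 : (π : ℂ) - z ≠ 0) (h2 : (π : ℂ) + z ≠ 0) :
    DifferentiableAt ℂ (rhoComplex c) z := by
  have : z ^ 2 - (π : ℂ) ^ 2 ≠ 0 := by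
    rw [show z ^ 2 - (π : ℂ) ^ 2 = -((π - z) * (π + z)) by ring]
    exact neg_ne_zero.2 (mul_ne_zero h1 h2)
  unfold rhoComplex
  fun_prop (disch := exact this)

/-- Meant for `w = π ∓ z`, with `s` the distance to the nearer endpoint. The nearer one (`a = s`)
gives a quantitative bound; the farther one only needs the right sign. -/
lemma re_inv_ge {a s : ℝ} {w : ℂ} (hs : 0 < s) (ha : s ≤ a) (hw : ‖w - a‖ ≤ s / 2) :
    0 ≤ (w⁻¹).re ∧ (a = s → 2 / (9 * s) ≤ (w⁻¹).re) ∧ w ≠ 0 := by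
  have h1 : |w.re - a| ≤ s / 2 := by
    have := (Complex.abs_re_le_norm (w - a)).trans hw
    simpa using this
  have hre : s / 2 ≤ w.re := by linarith [(abs_le.1 h1).1]
  have hw0 : w ≠ 0 := by
    rintro rfl
    simp at hre
    linarith
  have hpos : 0 < Complex.normSq w := Complex.normSq_pos.2 hw0
  rw [Complex.inv_re]
  refine ⟨div_nonneg (by linarith) hpos.le, ?_, hw0⟩
  rintro rfl
  have h2 : ‖w‖ ≤ 3 * a / 2 := by
    have := norm_add_le (w - a) a
    rw [sub_add_cancel, Complex.norm_real, Real.norm_of_nonneg hs.le] at this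
    linarith
  have h3 : Complex.normSq w ≤ (3 * a / 2) ^ 2 := by
    rw [Complex.normSq_eq_norm_sq]
    gcongr
  calc 2 / (9 * a) = (a / 2) / (3 * a / 2) ^ 2 := by field_simp; norm_num
    _ ≤ w.re / Complex.normSq w := by gcongr; linarith

lemma norm_rhoComplex_le {c : ℝ} (hc : 0 < c) {y : ℝ} (hy : |y| < π) {z : ℂ}
    (hz : ‖z - y‖ ≤ (π - |y|) / 2) :
    ‖rhoComplex c z‖ ≤ Real.exp c * Real.exp (-(c * π / 9) / (π - |y|)) ∧
      (π : ℂ) - z ≠ 0 ∧ (π : ℂ) + z ≠ 0 := by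
  set s := π - |y| with hs
  have hs0 : 0 < s := by linarith
  have hA := re_inv_ge (a := π - y) (w := π - z) hs0 (by linarith [le_abs_self y]) (by
    rwa [show (π : ℂ) - z - ((π - y : ℝ) : ℂ) = -(z - y) by push_cast; ring, norm_neg])
  have hB := re_inv_ge (a := π + y) (w := π + z) hs0 (by linarith [neg_abs_le y]) (by
    rwa [show (π : ℂ) + z - ((π + y : ℝ) : ℂ) = z - y by push_cast; ring])
  refine ⟨?_, hA.2.2, hB.2.2⟩
  have hne : z ^ 2 - (π : ℂ) ^ 2 ≠ 0 := by
    rw [show z ^ 2 - (π : ℂ) ^ 2 = -((π - z) * (π + z)) by ring]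
    exact neg_ne_zero.2 (mul_ne_zero hA.2.2 hB.2.2)
  -- Partial fractions isolate the two poles, so the decay comes from the real parts of `1/(π ∓ z)`.
  have hid : (c : ℂ) * z ^ 2 / (z ^ 2 - π ^ 2) =
      (c : ℂ) - ((c * π / 2 : ℝ) : ℂ) * (((π : ℂ) - z)⁻¹ + ((π : ℂ) + z)⁻¹) := by
    have h1 := hA.2.2
    have h2 := hB.2.2
    push_cast
    field_simp
    ring
  have hsum : 2 / (9 * s) ≤ (((π : ℂ) - z)⁻¹).re + (((π : ℂ) + z)⁻¹).re := by
    rcases abs_choice y with h | h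
    · have := hA.2.1 (by rw [hs, h])
      linarith [hB.1]
    · have := hB.2.1 (by rw [hs, h]; ring)
      linarith [hA.1]
  rw [rhoComplex, Complex.norm_exp, hid, Complex.sub_re, Complex.re_ofReal_mul, Complex.ofReal_re,
    Complex.add_re, ← Real.exp_add]
  apply Real.exp_le_exp.2
  have : c * π / 2 * (2 / (9 * s)) = c * π / 9 / s := by field_simp
  have h4 : c * π / 2 * (2 / (9 * s)) ≤
      c * π / 2 * ((((π : ℂ) - z)⁻¹).re + (((π : ℂ) + z)⁻¹).re) := by gcongr
  rw [neg_div]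
  linarith

lemma rho_eventuallyEq (c : ℝ) {y : ℝ} (hy : |y| < π) :
    (fun u : ℝ => (rho c u : ℂ)) =ᶠ[𝓝 y] fun u : ℝ => rhoComplex c u := by
  filter_upwards [(continuous_abs.isOpen_preimage _ isOpen_Iio).mem_nhds hy] with u hu
    using rho_eq_rhoComplex c hu

lemma contDiffAt_rho (c : ℝ) {y : ℝ} (hy : |y| < π) :
    ContDiffAt ℝ (⊤ : ℕ∞) (fun u : ℝ => (rho c u : ℂ)) y := by
  refine ContDiffAt.congr_of_eventuallyEq ?_ (rho_eventuallyEq c hy)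
  have hne : ((y : ℂ) ^ 2 - (π : ℂ) ^ 2) ≠ 0 := by
    have : y ^ 2 - π ^ 2 ≠ 0 := by
      have := sq_lt_sq.2 (hy.trans_le (le_abs_self π))
      linarith
    exact_mod_cast this
  have h1 : ContDiffAt ℝ (⊤ : ℕ∞) (fun u : ℝ => (u : ℂ)) y := Complex.ofRealCLM.contDiff.contDiffAt
  simp only [rhoComplex, div_eq_mul_inv]
  exact ((contDiffAt_const.mul (h1.pow 2)).mul (((h1.pow 2).sub contDiffAt_const).inv hne)).cexp

/-- Cauchy's estimate on the disc whose radius is half the distance to the nearer endpoint. -/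
lemma norm_iteratedDeriv_rho_le {c : ℝ} (hc : 0 < c) {y : ℝ} (hy : |y| < π) (k : ℕ) :
    ‖iteratedDeriv k (fun u : ℝ => (rho c u : ℂ)) y‖ ≤
      k.factorial * (Real.exp c * Real.exp (-(c * π / 9) / (π - |y|))) / ((π - |y|) / 2) ^ k := by
  have hs0 : 0 < (π - |y|) / 2 := by linarith
  have hd : ∀ z ∈ Metric.closedBall (y : ℂ) ((π - |y|) / 2),
      DifferentiableAt ℂ (rhoComplex c) z := by
    intro z hz
    obtain ⟨-, h1, h2⟩ := norm_rhoComplex_le hc hy (mem_closedBall_iff_norm.1 hz)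
    exact differentiableAt_rhoComplex c h1 h2
  rw [(rho_eventuallyEq c hy).iteratedDeriv_eq, iteratedDeriv_comp_ofReal Metric.isOpen_ball
    (fun z hz => (hd z (Metric.ball_subset_closedBall hz)).differentiableWithinAt) k y
    (Metric.mem_ball_self hs0)]
  refine Complex.norm_iteratedDeriv_le_of_forall_mem_sphere_norm_le k hs0 ?_ ?_
  · refine DifferentiableOn.diffContOnCl_ball (U := Metric.closedBall (y : ℂ) ((π - |y|) / 2)) ?_
      subset_rfl
    exact fun z hz => (hd z hz).differentiableWithinAt
  · intro z hz
    exact (norm_rhoComplex_le hc hy (mem_sphere_iff_norm.1 hz).le).1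

lemma exp_neg_div_le {b s : ℝ} (hb : 0 < b) (hs : 0 < s) (k : ℕ) :
    Real.exp (-b / s) ≤ s ^ k * (k.factorial / b ^ k) := by
  have h := Real.pow_div_factorial_le_exp (b / s) (by positivity) k
  rw [neg_div, Real.exp_neg]
  calc (Real.exp (b / s))⁻¹ ≤ ((b / s) ^ k / k.factorial)⁻¹ := by gcongr
    _ = s ^ k * (k.factorial / b ^ k) := by rw [div_pow]; field_simp

/-- The exponential absorbs the `k` negative powers of `π - |y|` at the price of a second `k!`. -/
lemma norm_iteratedDeriv_rho_le_gevrey {c : ℝ} (hc : 0 < c) {y : ℝ} (hy : |y| < π) (k : ℕ) :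
    ‖iteratedDeriv k (fun u : ℝ => (rho c u : ℂ)) y‖ ≤
      Real.exp c * (18 / (c * π)) ^ k * (k.factorial : ℝ) ^ 2 := by
  have hs0 : 0 < π - |y| := by linarith
  refine (norm_iteratedDeriv_rho_le hc hy k).trans ?_
  have hb : 0 < c * π / 9 := by positivity
  have h := exp_neg_div_le hb hs0 k
  calc (k.factorial : ℝ) * (Real.exp c * Real.exp (-(c * π / 9) / (π - |y|))) / ((π - |y|) / 2) ^ k
      ≤ k.factorial * (Real.exp c * ((π - |y|) ^ k * (k.factorial / (c * π / 9) ^ k))) /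
        ((π - |y|) / 2) ^ k := by gcongr
    _ = Real.exp c * (18 / (c * π)) ^ k * (k.factorial : ℝ) ^ 2 := by
      rw [show (18 / (c * π)) = 2 / (c * π / 9) by field_simp; norm_num]
      generalize c * π / 9 = b at hb
      rw [div_pow, div_pow]
      field_simp

/-- Spending two more powers of the exponential leaves a factor `(π - |y|)²`, the flatness needed to
glue with zero at `±π`. -/
lemma norm_iteratedDeriv_rho_le_flat {c : ℝ} (hc : 0 < c) {y : ℝ} (hy : |y| < π) (k : ℕ) :
    ‖iteratedDeriv k (fun u : ℝ => (rho c u : ℂ)) y‖ ≤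
      Real.exp c * k.factorial * 2 ^ k * ((k + 2).factorial / (c * π / 9) ^ (k + 2)) *
        (π - |y|) ^ 2 := by
  have hs0 : 0 < π - |y| := by linarith
  refine (norm_iteratedDeriv_rho_le hc hy k).trans ?_
  have hb : 0 < c * π / 9 := by positivity
  have h := exp_neg_div_le hb hs0 (k + 2)
  calc (k.factorial : ℝ) * (Real.exp c * Real.exp (-(c * π / 9) / (π - |y|))) / ((π - |y|) / 2) ^ k
      ≤ k.factorial * (Real.exp c * ((π - |y|) ^ (k + 2) *
        ((k + 2).factorial / (c * π / 9) ^ (k + 2)))) / ((π - |y|) / 2) ^ k := by gcongr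
    _ = _ := by
      rw [div_pow (π - |y|)]
      generalize ((k + 2).factorial / (c * π / 9) ^ (k + 2) : ℝ) = W
      field_simp
      ring

/-! ### Smoothness and Gevrey bounds of the localized function -/

lemma iteratedDeriv_comp_sub_mul (f : ℝ → ℂ) (x θ : ℝ) (k : ℕ) :
    iteratedDeriv k (fun u => f (x - θ * u)) =
      fun u => (-θ) ^ k • iteratedDeriv k f (x - θ * u) := by
  induction k with
  | zero => simp
  | succ k ih =>
    rw [iteratedDeriv_succ, ih]
    funext u
    have h : deriv (fun u => iteratedDeriv k f (x - θ * u)) u =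
        (-θ) • deriv (iteratedDeriv k f) (x - θ * u) := by
      have := deriv_comp_mul_left (-θ) (fun v => iteratedDeriv k f (x + v)) u
      simp only [deriv_comp_const_add, neg_mul, ← sub_eq_add_neg] at this
      exact this
    have h2 := deriv_fun_const_smul_field (x := u) ((-θ) ^ k)
      (fun u => iteratedDeriv k f (x - θ * u))
    rw [h2, h, smul_smul, ← pow_succ, iteratedDeriv_succ]

lemma hasDerivAt_zero_of_flat {G : ℝ → ℂ} {C : ℝ} (h0 : ∀ y, π ≤ |y| → G y = 0)
    (hG : ∀ y, |y| < π → ‖G y‖ ≤ C * (π - |y|) ^ 2) {y : ℝ} (hy : π ≤ |y|) :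
    HasDerivAt G 0 y := by
  have hO : G =O[𝓝 y] fun z => ‖z - y‖ ^ 2 := by
    refine IsBigO.of_bound (max C 0) (Eventually.of_forall fun z => ?_)
    rw [norm_pow, norm_norm]
    rcases lt_or_ge |z| π with hz | hz
    · refine (hG z hz).trans ?_
      have h1 : π - |z| ≤ ‖z - y‖ := by
        have := abs_sub_abs_le_abs_sub y z
        rw [abs_sub_comm] at this
        rw [Real.norm_eq_abs]
        linarith
      have h2 : (π - |z|) ^ 2 ≤ ‖z - y‖ ^ 2 := by
        have : 0 ≤ π - |z| := by linarith
        gcongr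
      calc C * (π - |z|) ^ 2 ≤ max C 0 * (π - |z|) ^ 2 := by gcongr; exact le_max_left _ _
        _ ≤ max C 0 * ‖z - y‖ ^ 2 := by gcongr
    · rw [h0 z hz, norm_zero]
      positivity
  have := (hO.hasFDerivAt (𝕜 := ℝ) one_lt_two).hasDerivAt
  simpa using this

/-- By induction on the order: a derivative that vanishes outside the window and is quadratically
small at its ends has derivative zero there. -/
lemma contDiff_of_flat {F : ℝ → ℂ} (h0 : ∀ y, π ≤ |y| → F y = 0)
    (hs : ∀ y, |y| < π → ContDiffAt ℝ (⊤ : ℕ∞) F y)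
    (hb : ∀ k : ℕ, ∃ C : ℝ, ∀ y, |y| < π → ‖iteratedDeriv k F y‖ ≤ C * (π - |y|) ^ 2) :
    ContDiff ℝ (⊤ : ℕ∞) F ∧ ∀ (k : ℕ) (y : ℝ), π ≤ |y| → iteratedDeriv k F y = 0 := by
  have hz : ∀ (k : ℕ) (y : ℝ), π ≤ |y| → iteratedDeriv k F y = 0 := by
    intro k
    induction k with
    | zero => simpa using h0
    | succ k ih =>
      intro y hy
      obtain ⟨C, hC⟩ := hb k
      rw [iteratedDeriv_succ]
      exact (hasDerivAt_zero_of_flat ih hC hy).deriv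
  refine ⟨contDiff_of_differentiable_iteratedDeriv fun k _ y => ?_, hz⟩
  rcases lt_or_ge |y| π with hy | hy
  · exact (contDiffAt_iteratedDeriv (hs y hy) k).differentiableAt (by simp)
  · obtain ⟨C, hC⟩ := hb k
    exact (hasDerivAt_zero_of_flat (hz k) hC hy).differentiableAt

/-- The localized function in the scaled window `|u| < π` around `x`. -/
noncomputable def localized (c : ℝ) (f : ℝ → ℂ) (x θ u : ℝ) : ℂ :=
  rho c u * f (x - θ * u)

lemma localized_eq_zero (c : ℝ) (f : ℝ → ℂ) (x θ : ℝ) {u : ℝ} (hu : π ≤ |u|) :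
    localized c f x θ u = 0 := by
  simp [localized, rho, not_lt.2 hu]

/-- One `i!` combines with `(k - i)!` and the binomial into `k!`, the other is at most `k!`; a spare
binomial, at least 1, is inserted to rebuild `(A + B)^k`. -/
lemma sum_choose_gevrey_le {A B : ℝ} (hA : 0 ≤ A) (hB : 0 ≤ B) (k : ℕ) :
    ∑ i ∈ Finset.range (k + 1), (k.choose i : ℝ) * (A ^ i * (i.factorial : ℝ) ^ 2) *
      ((k - i).factorial * B ^ (k - i)) ≤ (A + B) ^ k * (k.factorial : ℝ) ^ 2 := by
  rw [add_pow, Finset.sum_mul]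
  refine Finset.sum_le_sum fun i hi => ?_
  have hik : i ≤ k := Nat.lt_succ_iff.1 (Finset.mem_range.1 hi)
  have h1 : (k.choose i : ℝ) * i.factorial * (k - i).factorial = k.factorial := by
    exact_mod_cast Nat.choose_mul_factorial_mul_factorial hik
  have h2 : (i.factorial : ℝ) ≤ k.factorial := by exact_mod_cast Nat.factorial_le hik
  have h3 : (1 : ℝ) ≤ k.choose i := by exact_mod_cast Nat.choose_pos hik
  calc (k.choose i : ℝ) * (A ^ i * (i.factorial : ℝ) ^ 2) * ((k - i).factorial * B ^ (k - i))
      = (A ^ i * B ^ (k - i)) * (((k.choose i : ℝ) * i.factorial * (k - i).factorial) *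
        i.factorial) * 1 := by ring
    _ ≤ (A ^ i * B ^ (k - i)) * (k.factorial * k.factorial) * k.choose i := by rw [h1]; gcongr
    _ = _ := by ring

theorem localized_gevrey {c M r : ℝ} (hc : 0 < c) (hM : 0 < M) (hr : 0 < r) {f : ℝ → ℂ}
    {x θ : ℝ} (hθ0 : 0 ≤ θ) (hθ1 : θ ≤ 1)
    (hs : ∀ u : ℝ, |u| < π → ContDiffAt ℝ (⊤ : ℕ∞) f (x - θ * u))
    (hb : ∀ u : ℝ, |u| < π → ∀ k : ℕ,
      ‖iteratedDeriv k f (x - θ * u)‖ ≤ M * (Nat.factorial k : ℝ) / r ^ k) :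
    ContDiff ℝ (⊤ : ℕ∞) (localized c f x θ) ∧ ∀ (k : ℕ) (u : ℝ),
      ‖iteratedDeriv k (localized c f x θ) u‖ ≤
        M * Real.exp c * (18 / (c * π) + 1 / r) ^ k * (k.factorial : ℝ) ^ 2 := by
  have hgs : ∀ u : ℝ, |u| < π → ContDiffAt ℝ (⊤ : ℕ∞) (fun u => f (x - θ * u)) u := by
    intro u hu
    exact ContDiffAt.comp (f := fun u : ℝ => x - θ * u) u (hs u hu) (by fun_prop)
  have hgb : ∀ u : ℝ, |u| < π → ∀ k : ℕ, ‖iteratedDeriv k (fun u => f (x - θ * u)) u‖ ≤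
      M * ((Nat.factorial k : ℝ) * (1 / r) ^ k) := by
    intro u hu k
    rw [iteratedDeriv_comp_sub_mul, norm_smul, norm_pow, norm_neg, Real.norm_of_nonneg hθ0]
    calc θ ^ k * ‖iteratedDeriv k f (x - θ * u)‖ ≤ 1 * (M * (Nat.factorial k : ℝ) / r ^ k) := by
          gcongr
          · exact pow_le_one₀ hθ0 hθ1
          · exact hb u hu k
      _ = _ := by rw [one_div, inv_pow]; ring
  have hL : ∀ u : ℝ, |u| < π → ∀ (k : ℕ) (E : ℕ → ℝ),
      (∀ i, ‖iteratedDeriv i (fun u : ℝ => (rho c u : ℂ)) u‖ ≤ E i) →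
      ‖iteratedDeriv k (localized c f x θ) u‖ ≤ ∑ i ∈ Finset.range (k + 1),
        (k.choose i : ℝ) * E i * (M * ((k - i).factorial * (1 / r) ^ (k - i))) := by
    intro u hu k E hE
    have h1 : ContDiffAt ℝ k (fun u : ℝ => (rho c u : ℂ)) u :=
      (contDiffAt_rho c hu).of_le (mod_cast le_top)
    have h2 : ContDiffAt ℝ k (fun u => f (x - θ * u)) u := (hgs u hu).of_le (mod_cast le_top)
    have := iteratedDeriv_fun_mul h1 h2
    unfold localized
    rw [this]
    refine (norm_sum_le _ _).trans (Finset.sum_le_sum fun i _ => ?_)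
    rw [norm_mul, norm_mul, Complex.norm_natCast]
    have hE0 := (norm_nonneg _).trans (hE i)
    gcongr
    · exact hE i
    · exact hgb u hu _
  have hflat := contDiff_of_flat (F := localized c f x θ) (fun y hy => localized_eq_zero c f x θ hy)
    (fun y hy => (contDiffAt_rho c hy).mul (hgs y hy)) (by
      intro k
      refine ⟨∑ i ∈ Finset.range (k + 1), (k.choose i : ℝ) *
        (Real.exp c * i.factorial * 2 ^ i * ((i + 2).factorial / (c * π / 9) ^ (i + 2))) *
        (M * ((k - i).factorial * (1 / r) ^ (k - i))), fun y hy => ?_⟩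
      refine (hL y hy k _ fun i => norm_iteratedDeriv_rho_le_flat hc hy i).trans_eq ?_
      rw [Finset.sum_mul]
      exact Finset.sum_congr rfl fun i _ => by ring)
  refine ⟨hflat.1, fun k u => ?_⟩
  rcases lt_or_ge |u| π with hu | hu
  · refine (hL u hu k _ fun i => norm_iteratedDeriv_rho_le_gevrey hc hu i).trans ?_
    have h := sum_choose_gevrey_le (A := 18 / (c * π)) (B := 1 / r) (by positivity) (by positivity) k
    calc _ = M * Real.exp c * ∑ i ∈ Finset.range (k + 1), (k.choose i : ℝ) *
          ((18 / (c * π)) ^ i * (i.factorial : ℝ) ^ 2) *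
          ((k - i).factorial * (1 / r) ^ (k - i)) := by
          rw [Finset.mul_sum]
          exact Finset.sum_congr rfl fun i _ => by ring
      _ ≤ M * Real.exp c * ((18 / (c * π) + 1 / r) ^ k * (k.factorial : ℝ) ^ 2) := by gcongr
      _ = _ := by ring
  · rw [hflat.2 k u hu, norm_zero]
    positivity

/-! ### Root-exponential decay of the Fourier transform -/

lemma iteratedDeriv_eq_zero_of_abs_gt {F : ℝ → ℂ} (h0 : ∀ u, π ≤ |u| → F u = 0) (k : ℕ) {u : ℝ}
    (hu : π < |u|) : iteratedDeriv k F u = 0 := by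
  have : F =ᶠ[𝓝 u] fun _ => 0 := by
    filter_upwards [(continuous_abs.isOpen_preimage _ isOpen_Ioi).mem_nhds hu] with z hz
      using h0 z (le_of_lt hz)
  rw [this.iteratedDeriv_eq k]
  simp

lemma hasCompactSupport_of_abs {F : ℝ → ℂ} (h0 : ∀ u, π < |u| → F u = 0) :
    HasCompactSupport F := by
  refine HasCompactSupport.intro (K := Icc (-π) π) isCompact_Icc fun u hu => h0 u ?_
  by_contra h
  exact hu (abs_le.1 (not_lt.1 h))

lemma norm_fourier_le_of_bound {G : ℝ → ℂ} {C : ℝ} (h0 : ∀ u, π < |u| → G u = 0)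
    (hG : ∀ u, ‖G u‖ ≤ C) (ξ : ℝ) : ‖𝓕 G ξ‖ ≤ C * (2 * π) := by
  have h1 : ‖𝓕 G ξ‖ = ‖∫ v in Icc (-π) π, 𝐞 (-(v * ξ)) • G v‖ := by
    rw [Real.fourier_real_eq, MeasureTheory.setIntegral_eq_integral_of_forall_compl_eq_zero]
    intro v hv
    have : π < |v| := by
      by_contra h
      exact hv (abs_le.1 (not_lt.1 h))
    rw [h0 v this, smul_zero]
  rw [h1]
  refine (MeasureTheory.norm_setIntegral_le_of_norm_le_const (C := C) (by simp) ?_).trans_eq ?_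
  · intro v _
    rw [Circle.norm_smul]
    exact hG v
  · rw [Real.volume_real_Icc_of_le (by linarith [Real.pi_pos])]
    ring

lemma pow_mul_norm_fourier_le {F : ℝ → ℂ} {C : ℝ} (hF : ContDiff ℝ (⊤ : ℕ∞) F)
    (h0 : ∀ u, π ≤ |u| → F u = 0) {k : ℕ} (hk : ∀ u, ‖iteratedDeriv k F u‖ ≤ C) (ξ : ℝ) :
    (2 * π * |ξ|) ^ k * ‖𝓕 F ξ‖ ≤ C * (2 * π) := by
  have hint : ∀ n : ℕ, (n : ℕ∞) ≤ ⊤ → MeasureTheory.Integrable (iteratedDeriv n F) := by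
    intro n _
    exact (hF.continuous_iteratedDeriv n (mod_cast le_top)).integrable_of_hasCompactSupport
      (hasCompactSupport_of_abs fun u hu => iteratedDeriv_eq_zero_of_abs_gt h0 n hu)
  have h := congrFun (Real.fourier_iteratedDeriv hF hint (n := k) le_top) ξ
  have h2 := norm_fourier_le_of_bound (fun u hu => iteratedDeriv_eq_zero_of_abs_gt h0 k hu) hk ξ
  rw [h, norm_smul, norm_pow] at h2
  simpa [abs_of_pos Real.pi_pos] using h2

lemma exists_gevrey_le_exp {A t : ℝ} (hA : 0 < A) (ht : 0 < t) :
    ∃ k : ℕ, A ^ k * (k.factorial : ℝ) ^ 2 / t ^ k ≤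
      Real.exp 1 * Real.exp (-√(t / (Real.exp 1 * A))) := by
  set τ := √(t / (Real.exp 1 * A)) with hτ
  have hτ0 : 0 ≤ τ := Real.sqrt_nonneg _
  have hτ2 : τ ^ 2 = t / (Real.exp 1 * A) := Real.sq_sqrt (by positivity)
  -- This order makes `A k²/t ≤ 1/e`, so the `k`-th power is at most `e^{-k}`; the prefactor `e`
  -- pays for the floor.
  refine ⟨⌊τ⌋₊, ?_⟩
  set k := ⌊τ⌋₊ with hk
  have hk1 : (k : ℝ) ≤ τ := Nat.floor_le hτ0
  have hk2 : τ < k + 1 := Nat.lt_floor_add_one τ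
  have hf : (k.factorial : ℝ) ≤ (k : ℝ) ^ k := by exact_mod_cast Nat.factorial_le_pow k
  have hbase : A * (k : ℝ) ^ 2 / t ≤ Real.exp (-1) := by
    have h1 : (k : ℝ) ^ 2 ≤ t / (Real.exp 1 * A) := by
      rw [← hτ2]
      gcongr
    calc A * (k : ℝ) ^ 2 / t ≤ A * (t / (Real.exp 1 * A)) / t := by gcongr
      _ = Real.exp (-1) := by rw [Real.exp_neg]; field_simp
  calc A ^ k * (k.factorial : ℝ) ^ 2 / t ^ k ≤ A ^ k * ((k : ℝ) ^ k) ^ 2 / t ^ k := by gcongr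
    _ = (A * (k : ℝ) ^ 2 / t) ^ k := by rw [div_pow, mul_pow, ← pow_mul, ← pow_mul, mul_comm k 2]
    _ ≤ Real.exp (-1) ^ k := by gcongr
    _ = Real.exp (-k) := by rw [← Real.exp_nat_mul]; congr 1; ring
    _ ≤ Real.exp 1 * Real.exp (-τ) := by
      rw [← Real.exp_add]
      exact Real.exp_le_exp.2 (by linarith)

theorem exists_fourier_decay {A : ℝ} (hA : 0 < A) :
    ∃ a K : ℝ, 0 < a ∧ 0 < K ∧ ∀ (B : ℝ) (F : ℝ → ℂ), ContDiff ℝ (⊤ : ℕ∞) F →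
      (∀ u, π ≤ |u| → F u = 0) →
      (∀ (k : ℕ) (u : ℝ), ‖iteratedDeriv k F u‖ ≤ B * A ^ k * (k.factorial : ℝ) ^ 2) →
      ∀ ξ : ℝ, ξ ≠ 0 → ‖𝓕 F ξ‖ ≤
        B * K * (Real.exp (-(a * √(2 * π * |ξ|))) / (2 * π * |ξ|) ^ 2) := by
  set b := 1 / √(Real.exp 1 * A) with hb
  have hb0 : 0 < b := by positivity
  refine ⟨b / 2, 2 * π * Real.exp 1 * (Nat.factorial 4 / (b / 2) ^ 4), by positivity,
    by positivity, ?_⟩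
  intro B F hF h0 hbd ξ hξ
  set t := 2 * π * |ξ| with ht
  have ht0 : 0 < t := by positivity
  have hB : 0 ≤ B := by
    have := (norm_nonneg _).trans (hbd 0 0)
    simpa using this
  obtain ⟨k, hk⟩ := exists_gevrey_le_exp hA ht0
  have h1 := pow_mul_norm_fourier_le hF h0 (hbd k) ξ
  rw [← ht] at h1
  have hsq : √(t / (Real.exp 1 * A)) = b * √t := by
    rw [Real.sqrt_div ht0.le, hb]
    ring
  rw [hsq] at hk
  -- Half of the exponent is spent on a factor `1/t²`, which makes the sums over aliases and tails
  -- converge.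
  have h2 : Real.exp (-(b * √t)) ≤
      (Nat.factorial 4 / (b / 2) ^ 4) * (Real.exp (-(b / 2 * √t)) / t ^ 2) := by
    have h3 := Real.pow_div_factorial_le_exp (b / 2 * √t) (by positivity) 4
    have h4 : (b / 2 * √t) ^ 4 = (b / 2) ^ 4 * t ^ 2 := by
      rw [mul_pow, show √t ^ 4 = (√t ^ 2) ^ 2 by ring, Real.sq_sqrt ht0.le]
    rw [h4] at h3
    have h5 : Real.exp (-(b / 2 * √t)) ≤ (Nat.factorial 4 / (b / 2) ^ 4) / t ^ 2 := by
      rw [Real.exp_neg]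
      calc (Real.exp (b / 2 * √t))⁻¹ ≤ ((b / 2) ^ 4 * t ^ 2 / Nat.factorial 4)⁻¹ := by gcongr
        _ = _ := by field_simp
    calc Real.exp (-(b * √t)) = Real.exp (-(b / 2 * √t)) * Real.exp (-(b / 2 * √t)) := by
          rw [← Real.exp_add]; congr 1; ring
      _ ≤ ((Nat.factorial 4 / (b / 2) ^ 4) / t ^ 2) * Real.exp (-(b / 2 * √t)) := by gcongr
      _ = _ := by ring
  calc ‖𝓕 F ξ‖ ≤ B * A ^ k * (k.factorial : ℝ) ^ 2 * (2 * π) / t ^ k := by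
        rw [le_div_iff₀ (by positivity), mul_comm]
        exact h1
    _ = 2 * π * B * (A ^ k * (k.factorial : ℝ) ^ 2 / t ^ k) := by ring
    _ ≤ 2 * π * B * (Real.exp 1 * ((Nat.factorial 4 / (b / 2) ^ 4) *
        (Real.exp (-(b / 2 * √t)) / t ^ 2))) := by
      gcongr
      exact hk.trans (by gcongr)
    _ = _ := by ring

/-! ### Poisson summation: aliasing and truncation -/

/-- Since `1/0 = 0` here, the hypothesis is meant for sets `s` containing `0`, as in both
applications. -/
lemma norm_tsum_sub_sum_le {g : ℤ → ℂ} {D : ℝ} (s : Finset ℤ)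
    (hg : ∀ j ∉ s, ‖g j‖ ≤ D * (1 / (j : ℝ) ^ 2)) (hD : 0 ≤ D) :
    ‖∑' j, g j - ∑ j ∈ s, g j‖ ≤ D * ∑' j : ℤ, 1 / (j : ℝ) ^ 2 := by
  classical
  have hZ : Summable fun j : ℤ => D * (1 / (j : ℝ) ^ 2) :=
    (Real.summable_one_div_int_pow.2 one_lt_two).mul_left D
  have hle : ∀ j, ‖if j ∈ s then 0 else g j‖ ≤ D * (1 / (j : ℝ) ^ 2) := by
    intro j
    split_ifs with h
    · rw [norm_zero]
      positivity
    · exact hg j h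
  have hs1 : HasSum (fun j => if j ∈ s then g j else 0) (∑ j ∈ s, g j) := by
    rw [← Finset.sum_congr rfl fun j hj => if_pos (c := j ∈ s) (e := (0 : ℂ)) hj]
    exact hasSum_sum_of_ne_finset_zero fun j hj => if_neg hj
  have hs2 : Summable fun j => if j ∈ s then 0 else g j := Summable.of_norm_bounded hZ hle
  have hsum := (hs1.add hs2.hasSum).tsum_eq
  have hfun : (fun j => (if j ∈ s then g j else 0) + if j ∈ s then 0 else g j) = g := by
    funext j
    split_ifs <;> simp
  rw [hfun] at hsum
  rw [hsum, add_sub_cancel_left, ← tsum_mul_left]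
  exact tsum_of_norm_bounded hZ.hasSum hle

lemma fourier_affine_mul_exp (F : ℝ → ℂ) {h : ℝ} (hh : 0 < h) (u₀ κ j : ℝ) :
    𝓕 (fun s : ℝ => F (u₀ + h * s) * Complex.exp (κ * (u₀ + h * s : ℝ) * Complex.I)) j =
      (h⁻¹ : ℝ) * (Complex.exp ((2 * π * j * u₀ / h : ℝ) * Complex.I) *
        𝓕 F (j / h - κ / (2 * π))) := by
  have h1 : ∀ s : ℝ, 𝐞 (-(s * j)) •
      (F (u₀ + h * s) * Complex.exp (κ * (u₀ + h * s : ℝ) * Complex.I)) =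
      (fun v : ℝ => Complex.exp ((2 * π * j * u₀ / h : ℝ) * Complex.I) *
        (𝐞 (-(v * (j / h - κ / (2 * π)))) • F v)) (u₀ + h * s) := by
    intro s
    simp only [Circle.smul_def, Real.fourierChar_apply, smul_eq_mul]
    rw [mul_comm (F _), ← mul_assoc, ← mul_assoc, ← Complex.exp_add, ← Complex.exp_add]
    congr 2
    have hπ : (π : ℂ) ≠ 0 := by exact_mod_cast Real.pi_ne_zero
    have hhc : (h : ℂ) ≠ 0 := by exact_mod_cast hh.ne'
    push_cast
    field_simp
    ring
  rw [Real.fourier_real_eq, Real.fourier_real_eq]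
  simp_rw [h1]
  have h2 := MeasureTheory.Measure.integral_comp_mul_left
    (fun w : ℝ => (fun v : ℝ => Complex.exp ((2 * π * j * u₀ / h : ℝ) * Complex.I) *
        (𝐞 (-(v * (j / h - κ / (2 * π)))) • F v)) (u₀ + w)) h
  rw [h2, MeasureTheory.integral_add_left_eq_self
    (fun v : ℝ => Complex.exp ((2 * π * j * u₀ / h : ℝ) * Complex.I) *
        (𝐞 (-(v * (j / h - κ / (2 * π)))) • F v)) u₀, MeasureTheory.integral_const_mul,
    abs_of_pos (inv_pos.2 hh), Complex.real_smul]

lemma tsum_affine_mul_exp {F : ℝ → ℂ} (hF : ContDiff ℝ (⊤ : ℕ∞) F)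
    (h0 : ∀ u, π ≤ |u| → F u = 0) {h : ℝ} (hh : 0 < h) (u₀ κ : ℝ) :
    ∑' m : ℤ, F (u₀ + h * m) * Complex.exp (κ * (u₀ + h * m : ℝ) * Complex.I) =
      ∑' j : ℤ, (h⁻¹ : ℝ) * (Complex.exp ((2 * π * j * u₀ / h : ℝ) * Complex.I) *
        𝓕 F (j / h - κ / (2 * π))) := by
  set H : ℝ → ℂ := fun s => F (u₀ + h * s) * Complex.exp (κ * (u₀ + h * s : ℝ) * Complex.I)
    with hH
  have hHs : ContDiff ℝ (⊤ : ℕ∞) H := by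
    have hl : ContDiff ℝ (⊤ : ℕ∞) fun s : ℝ => u₀ + h * s := by fun_prop
    have hl' : ContDiff ℝ (⊤ : ℕ∞) fun s : ℝ => ((u₀ + h * s : ℝ) : ℂ) :=
      Complex.ofRealCLM.contDiff.comp hl
    exact (hF.comp hl).mul ((contDiff_const.mul hl').mul contDiff_const).cexp
  have hHc : HasCompactSupport H := by
    refine HasCompactSupport.intro (K := Icc ((-π - u₀) / h) ((π - u₀) / h)) isCompact_Icc ?_
    intro s hs
    have : π ≤ |u₀ + h * s| := by
      by_contra hlt
      rw [not_le, abs_lt] at hlt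
      apply hs
      constructor
      · rw [div_le_iff₀ hh]
        linarith
      · rw [le_div_iff₀ hh]
        linarith
    simp [hH, h0 _ this]
  have hP := SchwartzMap.tsum_eq_tsum_fourier (hHc.toSchwartzMap hHs) 0
  rw [SchwartzMap.fourier_coe] at hP
  have hco : ((hHc.toSchwartzMap hHs : SchwartzMap ℝ ℂ) : ℝ → ℂ) = H := rfl
  rw [hco] at hP
  simp only [zero_add, QuotientAddGroup.mk_zero, fourier_eval_zero, mul_one] at hP
  refine hP.trans (tsum_congr fun j => ?_)
  exact fourier_affine_mul_exp F hh u₀ κ j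

lemma exists_finset_window {h : ℝ} (hh : 0 < h) (u₀ : ℝ) :
    ∃ s : Finset ℤ, (∀ m ∉ s, π ≤ |u₀ + h * m|) ∧ (s.card : ℝ) ≤ 2 * π / h + 1 := by
  refine ⟨Finset.Icc ⌈(-π - u₀) / h⌉ ⌊(π - u₀) / h⌋, ?_, ?_⟩
  · intro m hm
    by_contra hlt
    rw [not_le, abs_lt] at hlt
    apply hm
    rw [Finset.mem_Icc, Int.ceil_le, Int.le_floor, div_le_iff₀ hh, le_div_iff₀ hh]
    constructor <;> linarith
  · rw [Int.card_Icc]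
    have h1 := Int.floor_le ((π - u₀) / h)
    have h2 := Int.le_ceil ((-π - u₀) / h)
    have h3 : (π - u₀) / h - (-π - u₀) / h = 2 * π / h := by ring
    have h4 : 0 < 2 * π / h := by positivity
    rcases le_total 0 (⌊(π - u₀) / h⌋ + 1 - ⌈(-π - u₀) / h⌉) with hp | hn
    · have : (((⌊(π - u₀) / h⌋ + 1 - ⌈(-π - u₀) / h⌉).toNat : ℤ) : ℝ) =
          ⌊(π - u₀) / h⌋ + 1 - ⌈(-π - u₀) / h⌉ := by
        rw [Int.toNat_of_nonneg hp]
        push_cast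
        ring
      rw [Int.cast_natCast] at this
      rw [this]
      linarith
    · rw [Int.toNat_of_nonpos hn]
      simp only [Nat.cast_zero]
      linarith

lemma card_Icc_neg (p : ℕ) : (Finset.Icc (-(p : ℤ)) (p : ℤ)).card = 2 * p + 1 := by
  rw [Int.card_Icc]
  omega

lemma norm_dirichlet_le (p : ℕ) (y : ℝ) : ‖dirichlet p y‖ ≤ (2 * p + 1) / (2 * π) := by
  have h1 : ‖∑ k ∈ Finset.Icc (-(p : ℤ)) (p : ℤ), Complex.exp ((k : ℂ) * y * Complex.I)‖ ≤
      2 * p + 1 := by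
    refine (norm_sum_le_of_le (f := fun k : ℤ => Complex.exp ((k : ℂ) * y * Complex.I)) _
      (n := fun _ => (1 : ℝ)) fun k _ => ?_).trans_eq ?_
    · have := Complex.norm_exp_ofReal_mul_I ((k : ℝ) * y)
      push_cast at this
      exact this.le
    · rw [Finset.sum_const, card_Icc_neg]
      simp
  rw [dirichlet, norm_mul]
  have h2 : ‖(1 : ℂ) / (2 * π)‖ = 1 / (2 * π) := by simp [abs_of_pos Real.pi_pos]
  rw [h2, div_mul_eq_mul_div, one_mul]
  gcongr

lemma norm_tsum_window_le {F : ℝ → ℂ} {M : ℝ} (h0 : ∀ u, π ≤ |u| → F u = 0)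
    (hM : ∀ u, ‖F u‖ ≤ M) {h : ℝ} (hh : 0 < h) (u₀ : ℝ) (p : ℕ) :
    ‖(h : ℂ) * ∑' m : ℤ, F (u₀ + h * m) * dirichlet p (u₀ + h * m)‖ ≤
      (2 * π + h) * (M * ((2 * p + 1) / (2 * π))) := by
  obtain ⟨s, hs, hcard⟩ := exists_finset_window hh u₀
  have hM0 : 0 ≤ M := (norm_nonneg _).trans (hM 0)
  rw [tsum_eq_sum (s := s) (fun m hm => by rw [h0 _ (hs m hm), zero_mul]), norm_mul,
    Complex.norm_real, Real.norm_of_nonneg hh.le]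
  have h1 : ‖∑ m ∈ s, F (u₀ + h * m) * dirichlet p (u₀ + h * m)‖ ≤
      s.card * (M * ((2 * p + 1) / (2 * π))) := by
    refine (norm_sum_le_of_le _ (n := fun _ => M * ((2 * p + 1) / (2 * π))) fun m _ => ?_).trans_eq
      (by rw [Finset.sum_const, nsmul_eq_mul])
    rw [norm_mul]
    gcongr
    · exact hM _
    · exact norm_dirichlet_le p _
  calc _ ≤ h * ((2 * π / h + 1) * (M * ((2 * p + 1) / (2 * π)))) := by
        gcongr
        exact h1.trans (by gcongr)
    _ = _ := by field_simp

theorem norm_tsum_sub_le_of_fourier_decay {F : ℝ → ℂ} (hF : ContDiff ℝ (⊤ : ℕ∞) F)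
    (h0 : ∀ u, π ≤ |u| → F u = 0) {Q a : ℝ} (hQ : 0 ≤ Q) (ha : 0 < a)
    (hdec : ∀ ξ : ℝ, ξ ≠ 0 → ‖𝓕 F ξ‖ ≤
      Q * (Real.exp (-(a * √(2 * π * |ξ|))) / (2 * π * |ξ|) ^ 2))
    {X : ℝ} (u₀ : ℝ) {p : ℕ} (hp : (p : ℝ) < 2 * X) :
    ‖((π / X : ℝ) : ℂ) * ∑' m : ℤ, F (u₀ + π / X * m) * dirichlet p (u₀ + π / X * m) - F 0‖ ≤
      Q * (∑' j : ℤ, 1 / (j : ℝ) ^ 2) / (2 * π) *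
        ((2 * p + 1) * (Real.exp (-(a * √(2 * X - p))) / (2 * X - p) ^ 2) +
          Real.exp (-(a * √p))) := by
  set Z := ∑' j : ℤ, 1 / (j : ℝ) ^ 2 with hZ
  have hX : 0 < X := by
    have : (0 : ℝ) ≤ p := by positivity
    linarith
  set h := π / X with hh
  have hh0 : 0 < h := by positivity
  have hdec' : ∀ t : ℝ, t ≠ 0 → ‖𝓕 F (t / (2 * π))‖ ≤
      Q * (Real.exp (-(a * √|t|)) / |t| ^ 2) := by
    intro t ht
    have := hdec (t / (2 * π)) (by positivity)
    rwa [abs_div, abs_of_pos (by positivity : 0 < 2 * π), mul_div_cancel₀ _ (by positivity)] at this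
  set I := Finset.Icc (-(p : ℤ)) (p : ℤ) with hI
  set T : ℤ → ℂ := fun k =>
    ∑' m : ℤ, F (u₀ + h * m) * Complex.exp ((k : ℝ) * (u₀ + h * m : ℝ) * Complex.I) with hT
  -- aliasing error of each frequency
  have halias : ∀ k ∈ I, ‖(h : ℂ) * T k - 𝓕 F (-k / (2 * π))‖ ≤
      Q * (Real.exp (-(a * √(2 * X - p))) / (2 * X - p) ^ 2) * Z := by
    intro k hk
    rw [hI, Finset.mem_Icc] at hk
    have hkp : |(k : ℝ)| ≤ p := abs_le.2 ⟨by exact_mod_cast hk.1, by exact_mod_cast hk.2⟩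
    have hTk : (h : ℂ) * T k = ∑' j : ℤ,
        Complex.exp ((2 * π * j * u₀ / h : ℝ) * Complex.I) * 𝓕 F (j / h - k / (2 * π)) := by
      rw [hT]
      simp only
      rw [tsum_affine_mul_exp hF h0 hh0 u₀ k, ← tsum_mul_left]
      refine tsum_congr fun j => ?_
      have hhc : (h : ℂ) ≠ 0 := by exact_mod_cast hh0.ne'
      push_cast
      rw [mul_inv_cancel_left₀ hhc]
    have h00 : 𝓕 F (-k / (2 * π)) = ∑ j ∈ ({0} : Finset ℤ),
        Complex.exp ((2 * π * j * u₀ / h : ℝ) * Complex.I) * 𝓕 F (j / h - k / (2 * π)) := by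
      simp [neg_div]
    rw [hTk, h00]
    refine norm_tsum_sub_sum_le _ (fun j hj => ?_) (by positivity)
    have hj0 : j ≠ 0 := by simpa using hj
    rw [norm_mul, Complex.norm_exp_ofReal_mul_I, one_mul]
    have hfreq : (j : ℝ) / h - k / (2 * π) = (2 * X * j - k) / (2 * π) := by
      rw [hh]
      field_simp
    have hj1 : (1 : ℝ) ≤ |(j : ℝ)| := by exact_mod_cast Int.one_le_abs hj0
    -- The factor `|j|` is kept: squared in the denominator, it makes the sum over aliases converge.
    have hge : |(j : ℝ)| * (2 * X - p) ≤ |2 * X * j - k| := by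
      have h1 := abs_sub_abs_le_abs_sub (2 * X * j) (k : ℝ)
      rw [abs_mul, abs_of_pos (by positivity : 0 < 2 * X)] at h1
      have : (p : ℝ) ≤ |(j : ℝ)| * p := le_mul_of_one_le_left (by positivity) hj1
      linarith
    have hgap : 0 < 2 * X - p := by linarith
    have hge' : 2 * X - p ≤ |2 * X * j - k| :=
      (le_mul_of_one_le_left hgap.le hj1).trans hge
    rw [hfreq]
    refine (hdec' _ (abs_pos.1 (hgap.trans_le hge'))).trans ?_
    have hsq : (j : ℝ) ^ 2 = |(j : ℝ)| ^ 2 := (sq_abs _).symm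
    calc Q * (Real.exp (-(a * √|2 * X * j - k|)) / |2 * X * j - k| ^ 2)
        ≤ Q * (Real.exp (-(a * √(2 * X - p))) / (|(j : ℝ)| * (2 * X - p)) ^ 2) := by gcongr
      _ = _ := by rw [hsq, mul_pow]; field_simp
  -- truncation error
  have htrunc : ‖(2 * π : ℂ) * F 0 - ∑ k ∈ I, 𝓕 F (-k / (2 * π))‖ ≤
      Q * Real.exp (-(a * √p)) * Z := by
    -- With step `2π` and no shift, only the sample at `0` meets the support, which gives the
    -- Fourier series of `F` at `0`.
    have hP := tsum_affine_mul_exp hF h0 (by positivity : 0 < 2 * π) 0 0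
    have hL : ∑' m : ℤ, F (0 + 2 * π * m) *
        Complex.exp ((0 : ℝ) * (0 + 2 * π * m : ℝ) * Complex.I) = F 0 := by
      rw [tsum_eq_single 0]
      · simp
      · intro m hm
        have hm1 : (1 : ℝ) ≤ |(m : ℝ)| := by exact_mod_cast Int.one_le_abs hm
        rw [h0, zero_mul]
        rw [zero_add, abs_mul, abs_of_pos (by positivity : 0 < 2 * π)]
        nlinarith [Real.pi_pos]
    have hR : (2 * π : ℂ) * F 0 = ∑' k : ℤ, 𝓕 F (-k / (2 * π)) := by
      rw [← hL, hP, ← tsum_mul_left, ← (Equiv.neg ℤ).tsum_eq]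
      refine tsum_congr fun k => ?_
      have : (2 * π : ℂ) ≠ 0 := by exact_mod_cast (by positivity : (2 * π : ℝ) ≠ 0)
      simp only [Equiv.neg_apply, mul_zero, zero_div, Complex.ofReal_zero, zero_mul,
        Complex.exp_zero, one_mul, sub_zero, Int.cast_neg]
      push_cast
      rw [mul_inv_cancel_left₀ this]
    rw [hR]
    refine norm_tsum_sub_sum_le I (fun k hk => ?_) (by positivity)
    have hkp : p ≤ |k| := by
      by_contra hlt
      rw [not_le, abs_lt] at hlt
      exact hk (Finset.mem_Icc.2 ⟨by omega, by omega⟩)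
    have hkp' : (p : ℝ) ≤ |(k : ℝ)| := by exact_mod_cast hkp
    have hk0 : (k : ℝ) ≠ 0 := by
      rintro h
      apply hk
      have : k = 0 := by exact_mod_cast h
      rw [this]
      exact Finset.mem_Icc.2 ⟨by omega, by omega⟩
    refine (hdec' _ (neg_ne_zero.2 hk0)).trans ?_
    rw [abs_neg, sq_abs, mul_one_div, ← mul_div_assoc]
    gcongr
  -- reassembly
  have hsumm : ∀ k ∈ I, Summable fun m : ℤ =>
      F (u₀ + h * m) * Complex.exp ((k : ℝ) * (u₀ + h * m : ℝ) * Complex.I) := by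
    intro k _
    obtain ⟨s, hs, -⟩ := exists_finset_window hh0 u₀
    exact summable_of_ne_finset_zero (s := s) fun m hm => by rw [h0 _ (hs m hm), zero_mul]
  have hsplit : (h : ℂ) * ∑' m : ℤ, F (u₀ + h * m) * dirichlet p (u₀ + h * m) =
      1 / (2 * π) * ∑ k ∈ I, (h : ℂ) * T k := by
    rw [← Finset.mul_sum, hT]
    simp only
    rw [← Summable.tsum_finsetSum hsumm, ← mul_assoc, mul_comm (1 / (2 * π) : ℂ), mul_assoc,
      ← tsum_mul_left (a := (1 / (2 * π) : ℂ))]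
    congr 1
    refine tsum_congr fun m => ?_
    rw [dirichlet, Finset.mul_sum, Finset.mul_sum, Finset.mul_sum]
    refine Finset.sum_congr rfl fun k _ => ?_
    push_cast
    ring
  have h2π : (2 * π : ℂ) ≠ 0 := by exact_mod_cast (by positivity : (2 * π : ℝ) ≠ 0)
  have hfin : 1 / (2 * π) * ∑ k ∈ I, (h : ℂ) * T k - F 0 =
      1 / (2 * π) * (∑ k ∈ I, ((h : ℂ) * T k - 𝓕 F (-k / (2 * π))) -
        ((2 * π : ℂ) * F 0 - ∑ k ∈ I, 𝓕 F (-k / (2 * π)))) := by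
    rw [Finset.sum_sub_distrib]
    have := Complex.ofReal_ne_zero.2 Real.pi_ne_zero
    field_simp
    ring
  rw [hsplit, hfin, norm_mul]
  have hn : ‖(1 : ℂ) / (2 * π)‖ = 1 / (2 * π) := by simp [abs_of_pos Real.pi_pos]
  have hs1 : ‖∑ k ∈ I, ((h : ℂ) * T k - 𝓕 F (-k / (2 * π)))‖ ≤
      (2 * p + 1) * (Q * (Real.exp (-(a * √(2 * X - p))) / (2 * X - p) ^ 2) * Z) := by
    refine (norm_sum_le_of_le _ halias).trans_eq ?_
    rw [Finset.sum_const, hI, card_Icc_neg, nsmul_eq_mul]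
    push_cast
    ring
  rw [hn]
  calc _ ≤ 1 / (2 * π) * ((2 * p + 1) * (Q * (Real.exp (-(a * √(2 * X - p))) /
        (2 * X - p) ^ 2) * Z) + Q * Real.exp (-(a * √p)) * Z) := by
        gcongr
        exact (norm_sub_le _ _).trans (add_le_add hs1 htrunc)
    _ = _ := by ring

/-! ### From the grid on the circle to a lattice on the line -/

lemma pi_le_abs_add_int_mul {r : ℝ} (hr : r ∈ Ioc (-π) (-π + 2 * π)) {n : ℤ} (hn : n ≠ 0) :
    π ≤ |r + n * (2 * π)| := by
  have hn1 : (1 : ℝ) ≤ |(n : ℝ)| := by exact_mod_cast Int.one_le_abs hn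
  have h1 := abs_sub_abs_le_abs_sub (n * (2 * π)) (-r)
  rw [sub_neg_eq_add, abs_neg, abs_mul, abs_of_pos Real.two_pi_pos, add_comm] at h1
  have h2 : |r| ≤ π := abs_le.2 ⟨hr.1.le, by linarith [hr.2]⟩
  nlinarith [Real.pi_pos]

/-- Write `m = 2N q + ν`: changing `q` moves the grid point by multiples of `2π`, and `G` vanishes
unless the difference is the representative in `(-π, π]`. -/
lemma sum_grid_eq_tsum {f G : ℝ → ℂ} (hf : Function.Periodic f (2 * π))
    (hG : ∀ y, π ≤ |y| → G y = 0) {N : ℕ} (hN : 0 < N) (x : ℝ) :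
    ∑ ν ∈ Finset.range (2 * N),
        G (toIocMod Real.two_pi_pos (-π) (x - gridPt N ν)) * f (gridPt N ν) =
      ∑' m : ℤ, G (x - π / N * m) * f (π / N * m) := by
  have hN' : (0 : ℝ) < N := by exact_mod_cast hN
  have : NeZero (2 * N) := ⟨by omega⟩
  set Φ : ℤ → ℂ := fun m => G (x - π / N * m) * f (π / N * m) with hΦ
  have hsum : Summable Φ := by
    obtain ⟨s, hs, -⟩ := exists_finset_window (show 0 < π / N by positivity) (-x)
    refine summable_of_ne_finset_zero (s := s) fun m hm => ?_
    have := hs m hm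
    rw [hΦ]
    simp only
    rw [hG, zero_mul]
    rw [← abs_neg]
    convert this using 2
    ring
  have hterm : ∀ ν : ℕ, G (toIocMod Real.two_pi_pos (-π) (x - gridPt N ν)) * f (gridPt N ν) =
      ∑' q : ℤ, Φ (q * (2 * N : ℕ) + ν) := by
    intro ν
    set r := toIocMod Real.two_pi_pos (-π) (x - gridPt N ν) with hr
    set q₀ := toIocDiv Real.two_pi_pos (-π) (x - gridPt N ν) with hq₀
    have hmem : r ∈ Ioc (-π) (-π + 2 * π) := toIocMod_mem_Ioc Real.two_pi_pos (-π) _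
    have hrq : r + q₀ * (2 * π) = x - gridPt N ν := by
      have := toIocMod_add_toIocDiv_zsmul Real.two_pi_pos (-π) (x - gridPt N ν)
      rwa [zsmul_eq_mul] at this
    have hpt : ∀ q : ℤ, π / N * ((q * (2 * N : ℕ) + ν : ℤ) : ℝ) = gridPt N ν + q * (2 * π) := by
      intro q
      rw [gridPt]
      push_cast
      field_simp
      ring
    have hx : ∀ q : ℤ, x - (gridPt N ν + q * (2 * π)) = r + (q₀ - q : ℤ) * (2 * π) := by
      intro q
      push_cast
      linarith
    rw [tsum_eq_single q₀]
    · simp only [hΦ]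
      rw [hpt, hx, hf.int_mul q₀ (gridPt N ν)]
      simp
    · intro q hq
      simp only [hΦ]
      rw [hpt, hx, hG _ (pi_le_abs_add_int_mul hmem (sub_ne_zero.2 hq.symm)), zero_mul]
  have hsum' : Summable fun z : Fin (2 * N) × ℤ => Φ (z.2 * (2 * N : ℕ) + (z.1 : ℕ)) := by
    have := ((Equiv.prodComm (Fin (2 * N)) ℤ).trans (Int.divModEquiv (2 * N)).symm).summable_iff.2
      hsum
    exact this
  rw [← ((Equiv.prodComm (Fin (2 * N)) ℤ).trans (Int.divModEquiv (2 * N)).symm).tsum_eq Φ]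
  have h2 : ∑' z : Fin (2 * N) × ℤ,
      Φ ((Equiv.prodComm (Fin (2 * N)) ℤ).trans (Int.divModEquiv (2 * N)).symm z) =
      ∑' z : Fin (2 * N) × ℤ, Φ (z.2 * (2 * N : ℕ) + (z.1 : ℕ)) := rfl
  rw [h2, hsum'.tsum_prod, tsum_fintype,
    Fin.sum_univ_eq_sum_range (fun ν => ∑' q : ℤ, Φ (q * (2 * N : ℕ) + (ν : ℕ)))]
  exact Finset.sum_congr rfl fun ν _ => hterm ν

lemma discreteConv_eq_tsum {f : ℝ → ℂ} (hf : Function.Periodic f (2 * π)) (c x : ℝ) (p : ℕ)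
    {θ : ℝ} (hθ0 : 0 < θ) (hθ1 : θ ≤ 1) {N : ℕ} (hN : 0 < N) :
    discreteConv c p θ N f x = ((π / (θ * N) : ℝ) : ℂ) * ∑' m : ℤ,
      localized c f x θ (x / θ + π / (θ * N) * m) * dirichlet p (x / θ + π / (θ * N) * m) := by
  have hN' : (0 : ℝ) < N := by exact_mod_cast hN
  have hpsi : ∀ y, π ≤ |y| → psi c p θ y = 0 := by
    intro y hy
    have : π ≤ |y / θ| := by
      rw [abs_div, abs_of_pos hθ0, le_div_iff₀ hθ0]
      nlinarith [Real.pi_pos]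
    simp [psi, rho, not_lt.2 this]
  rw [discreteConv, sum_grid_eq_tsum hf hpsi hN x, ← (Equiv.neg ℤ).tsum_eq, ← tsum_mul_left,
    ← tsum_mul_left]
  refine tsum_congr fun m => ?_
  have hu : (x - π / N * ((-m : ℤ) : ℝ)) / θ = x / θ + π / (θ * N) * m := by
    push_cast
    field_simp
    ring
  have hv : x - θ * (x / θ + π / (θ * N) * m) = π / N * ((-m : ℤ) : ℝ) := by
    push_cast
    field_simp
    ring
  rw [Equiv.neg_apply, psi, localized, hu, hv]
  have : (θ : ℂ) ≠ 0 := by exact_mod_cast hθ0.ne'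
  have : (N : ℂ) ≠ 0 := by exact_mod_cast hN.ne'
  push_cast
  field_simp

lemma localized_zero (c : ℝ) (f : ℝ → ℂ) (x θ : ℝ) : localized c f x θ 0 = f x := by
  simp [localized, rho, Real.pi_pos]

/-! ### Choice of the constants -/

/-- Here `log (β/e) ≥ -1`, and `β ≤ 2` makes the exponent on the right at most `b√X`; this is where
`η = b²/8` comes from. -/
lemma exp_neg_le_div_exp_rpow {b β X : ℝ} (hb : 0 < b) (hβ1 : 1 ≤ β) (hβ2 : β ≤ 2)
    (hX : 0 ≤ X) :
    Real.exp (-(b * √X)) ≤ (β / Real.exp 1) ^ (2 * √(β * (b ^ 2 / 8) * X)) := by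
  have hβ0 : 0 < β := by linarith
  have h1 : √(β * (b ^ 2 / 8) * X) ≤ b / 2 * √X := by
    rw [← Real.sqrt_sq (by positivity : 0 ≤ b / 2), ← Real.sqrt_mul (by positivity)]
    apply Real.sqrt_le_sqrt
    nlinarith [mul_nonneg (mul_nonneg (sub_nonneg.2 hβ2) (sq_nonneg b)) hX]
  rw [Real.rpow_def_of_pos (by positivity), Real.log_div hβ0.ne' (Real.exp_pos 1).ne',
    Real.log_exp]
  apply Real.exp_le_exp.2
  have h2 := Real.log_nonneg hβ1
  have h3 : 0 ≤ √(β * (b ^ 2 / 8) * X) := Real.sqrt_nonneg _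
  nlinarith

lemma aliasing_add_truncation_le {a ε X p : ℝ} (ha : 0 ≤ a) (hε : 0 ≤ ε) (hε2 : ε ≤ 1 / 2)
    (hX : 1 ≤ X) (hp1 : ε * X ≤ p) (hp2 : p ≤ 3 / 2 * X) :
    (2 * p + 1) * (Real.exp (-(a * √(2 * X - p))) / (2 * X - p) ^ 2) + Real.exp (-(a * √p)) ≤
      17 * Real.exp (-(a * √ε * √X)) := by
  have hgap : X / 2 ≤ 2 * X - p := by linarith
  have hgap' : ε * X ≤ 2 * X - p := by
    have : ε * X ≤ 1 / 2 * X := by gcongr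
    linarith
  rw [mul_assoc a, ← Real.sqrt_mul hε]
  have h3 : (2 * p + 1) / (2 * X - p) ^ 2 ≤ 16 := by
    have h4 : (X / 2) ^ 2 ≤ (2 * X - p) ^ 2 := by gcongr
    have h5 : X * 1 ≤ X * X := by gcongr
    rw [div_le_iff₀ (lt_of_lt_of_le (by positivity) h4)]
    linarith
  calc _ = (2 * p + 1) / (2 * X - p) ^ 2 * Real.exp (-(a * √(2 * X - p))) +
        Real.exp (-(a * √p)) := by ring
    _ ≤ 16 * Real.exp (-(a * √(ε * X))) + Real.exp (-(a * √(ε * X))) := by gcongr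
    _ = _ := by ring

/-- The error bound at a single point, in terms of the resolution `X = θ(x) N`. -/
theorem norm_discreteConv_sub_le {f : ℝ → ℂ} (hf : Function.Periodic f (2 * π)) {c M r a K : ℝ}
    (hc : 0 < c) (hM : 0 < M) (hr : 0 < r) (ha : 0 < a) (hK : 0 < K)
    (hdec : ∀ (B : ℝ) (F : ℝ → ℂ), ContDiff ℝ (⊤ : ℕ∞) F →
      (∀ u, π ≤ |u| → F u = 0) →
      (∀ (k : ℕ) (u : ℝ), ‖iteratedDeriv k F u‖ ≤
        B * (18 / (c * π) + 1 / r) ^ k * (k.factorial : ℝ) ^ 2) →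
      ∀ ξ : ℝ, ξ ≠ 0 → ‖𝓕 F ξ‖ ≤
        B * K * (Real.exp (-(a * √(2 * π * |ξ|))) / (2 * π * |ξ|) ^ 2))
    {x : ℝ} (hx : LocalAnalyticBound f x M r) (hd : 0 < edgeDist f x) {N : ℕ} (hN : 0 < N)
    (p : ℕ) :
    (‖discreteConv c p (theta f x) N f x - f x‖ ≤
      (2 * π + π / (theta f x * N)) * (M * Real.exp c * ((2 * p + 1) / (2 * π))) +
        M * Real.exp c) ∧
    ((p : ℝ) < 2 * (theta f x * N) → ‖discreteConv c p (theta f x) N f x - f x‖ ≤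
      M * Real.exp c * K * (∑' j : ℤ, 1 / (j : ℝ) ^ 2) / (2 * π) *
        ((2 * p + 1) * (Real.exp (-(a * √(2 * (theta f x * N) - p))) /
          (2 * (theta f x * N) - p) ^ 2) + Real.exp (-(a * √p)))) := by
  have hN' : (0 : ℝ) < N := by exact_mod_cast hN
  set θ := theta f x with hθ
  have hdθ : edgeDist f x = π * θ := by
    rw [hθ, theta]
    field_simp
  have hθ0 : 0 < θ := div_pos hd Real.pi_pos
  have hθ1 : θ ≤ 1 := (div_le_one Real.pi_pos).2 (edgeDist_le_pi hf x)
  have hwin : ∀ u : ℝ, |u| < π → |x - θ * u - x| < edgeDist f x := by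
    intro u hu
    rw [sub_sub_cancel_left, abs_neg, abs_mul, abs_of_pos hθ0, hdθ, mul_comm]
    gcongr
  obtain ⟨hF, hFb⟩ := localized_gevrey (c := c) hc hM hr hθ0.le hθ1
    (fun u hu => (contDiffAt_of_abs_sub_lt (hwin u hu)).self_of_nhds)
    (fun u hu k => hx _ (hwin u hu) k)
  have h0 : ∀ u, π ≤ |u| → localized c f x θ u = 0 := fun u hu => localized_eq_zero c f x θ hu
  have hbd : ∀ u, ‖localized c f x θ u‖ ≤ M * Real.exp c := by
    intro u
    simpa using hFb 0 u
  rw [discreteConv_eq_tsum hf c x p hθ0 hθ1 hN]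
  rw [← localized_zero c f x θ]
  refine ⟨(norm_sub_le _ _).trans (add_le_add ?_ (hbd 0)), fun hp => ?_⟩
  · exact norm_tsum_window_le h0 hbd (by positivity) _ p
  · exact norm_tsum_sub_le_of_fourier_decay hF h0 (by positivity) ha (hdec _ _ hF h0 hFb) _ hp

theorem exists_uniform_constants {c : ℝ} (hc : 0 < c) {β₀ : ℝ} (hβ₀ : 1 < β₀) {δ : ℝ} (hδ : 0 < δ)
    {ω : ℝ → ℝ} (hω_mono : Monotone ω) (hω : ω =o[atTop] (fun t : ℝ => t))
    {M r : ℝ} (hM : 0 < M) (hr : 0 < r) :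
    ∃ C η : ℝ, 0 < C ∧ 0 < η ∧ ∀ f : ℝ → ℂ, Function.Periodic f (2 * π) →
      ∀ x : ℝ, LocalAnalyticBound f x M r →
      ∀ β : ℝ, β₀ ≤ β → β < 1.764 → β * Real.log β < 1 →
      ∀ N : ℕ, δ ≤ edgeDist f x * N →
      ∀ p : ℕ, |(p : ℝ) - β * Real.log β * theta f x * N| ≤ ω (theta f x * N) →
        ‖discreteConv c p (theta f x) N f x - f x‖ ≤
          C * (edgeDist f x * N) ^ 2 *
            (β / Real.exp 1) ^ (2 * Real.sqrt (β * η * theta f x * N)) := by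
  obtain ⟨a, K, ha, hK, hdec⟩ := exists_fourier_decay
    (show 0 < 18 / (c * π) + 1 / r by positivity)
  have hlog₀ : 0 < Real.log β₀ := Real.log_pos hβ₀
  set κ₀ := β₀ * Real.log β₀ with hκ₀
  have hκ₀pos : 0 < κ₀ := by positivity
  -- Once `ω X ≤ ε X`, the bound `κ₀/2` gives `p ≥ ε X`, and `1/2` with `κ < 1` gives `p ≤ 3X/2`.
  set ε := min (κ₀ / 2) (1 / 2) with hε
  have hε0 : 0 < ε := by positivity
  have hε1 : ε ≤ κ₀ / 2 := min_le_left _ _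
  have hε2 : ε ≤ 1 / 2 := min_le_right _ _
  obtain ⟨T₁, hT₁⟩ := eventually_atTop.1 (hω.bound hε0)
  set T := max T₁ 1 with hT
  set b := a * √ε with hb
  have hb0 : 0 < b := by positivity
  set Z := ∑' j : ℤ, 1 / (j : ℝ) ^ 2 with hZ
  have hZ0 : 0 ≤ Z := tsum_nonneg fun j => by positivity
  set B := M * Real.exp c with hB
  have hB0 : 0 < B := by positivity
  set C₁ := B * K * Z / (2 * π) * 17 with hC₁
  set P := T + |ω T| with hP
  set E := (2 * π + π / (δ / π)) * (B * ((2 * P + 1) / (2 * π))) + B with hE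
  have hT1 : 1 ≤ T := le_max_right _ _
  have hP0 : 0 ≤ P := by positivity
  have hE0 : 0 < E := by positivity
  -- Chosen so that `C₂ δ² exp(-b√T)` equals `E`, the crude bound valid for `X < T`.
  set C₂ := E * Real.exp (b * √T) / δ ^ 2 with hC₂
  refine ⟨C₁ + C₂ + 1, b ^ 2 / 8, by positivity, by positivity, ?_⟩
  intro f hf x hx β hβ1 hβ2 hβ3 N hN p hp
  set X := theta f x * N with hX
  have hdX : edgeDist f x * N = π * X := by
    rw [hX, theta]
    field_simp
  have hd0 := edgeDist_nonneg f x
  have hN0 : 0 < N := by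
    rcases Nat.eq_zero_or_pos N with h | h
    · rw [h, Nat.cast_zero, mul_zero] at hN
      linarith
    · exact h
  have hd : 0 < edgeDist f x := by
    rcases hd0.eq_or_lt with h | h
    · rw [← h, zero_mul] at hN
      linarith
    · exact h
  have hXδ : δ / π ≤ X := by
    rw [div_le_iff₀ Real.pi_pos, mul_comm, ← hdX]
    exact hN
  have hX0 : 0 < X := lt_of_lt_of_le (by positivity) hXδ
  obtain ⟨hsmall, hlarge⟩ := norm_discreteConv_sub_le hf hc hM hr ha hK hdec hx hd hN0 p
  rw [← hX, ← hB] at hsmall hlarge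
  have hexp := exp_neg_le_div_exp_rpow hb0 (hβ₀.le.trans hβ1) (by linarith : β ≤ 2) hX0.le
  rw [hX, ← mul_assoc] at hexp
  rw [← hX] at hexp
  rw [mul_assoc (β * Real.log β), ← hX] at hp
  have hβ0 : 0 < β := by linarith
  have hβlog : κ₀ ≤ β * Real.log β := by
    have : Real.log β₀ ≤ Real.log β := Real.log_le_log (by linarith) hβ1
    rw [hκ₀]
    gcongr
  have hp' := abs_le.1 hp
  have hκX : β * Real.log β * X ≤ X := mul_le_of_le_one_left hX0.le hβ3.le
  have hκX' : κ₀ * X ≤ β * Real.log β * X := mul_le_mul_of_nonneg_right hβlog hX0.le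
  have hε1X : ε * X ≤ κ₀ / 2 * X := mul_le_mul_of_nonneg_right hε1 hX0.le
  have hε2X : ε * X ≤ 1 / 2 * X := mul_le_mul_of_nonneg_right hε2 hX0.le
  set R := (β / Real.exp 1) ^ (2 * √(β * (b ^ 2 / 8) * theta f x * N)) with hR
  have hR0 : 0 < R := (Real.exp_pos _).trans_le hexp
  rw [hdX]
  rcases lt_or_ge X T with hXT | hXT
  -- Bounded resolution: monotonicity of `ω` bounds `p`, and `X ≥ δ/π` bounds the lattice step.
  · have hpP : (p : ℝ) ≤ P := by
      have h1 : ω X ≤ |ω T| := (hω_mono hXT.le).trans (le_abs_self _)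
      have h2 : β * Real.log β * X ≤ T := hκX.trans hXT.le
      rw [hP]
      linarith [hp'.2]
    have h1 : ‖discreteConv c p (theta f x) N f x - f x‖ ≤ E := by
      refine hsmall.trans ?_
      rw [hE]
      gcongr
    have h2 : Real.exp (-(b * √T)) ≤ R := by
      refine le_trans ?_ hexp
      gcongr
    have h3 : δ ^ 2 ≤ (π * X) ^ 2 := by
      rw [← hdX]
      gcongr
    calc _ ≤ E := h1
      _ = C₂ * δ ^ 2 * Real.exp (-(b * √T)) := by
        rw [hC₂, Real.exp_neg]
        field_simp
      _ ≤ (C₁ + C₂ + 1) * (π * X) ^ 2 * R := by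
        gcongr
        have : 0 ≤ C₁ := by positivity
        linarith
  · have hX1 : 1 ≤ X := hT1.trans hXT
    have hωX : ω X ≤ ε * X := by
      have := hT₁ X ((le_max_left _ _).trans hXT)
      rw [Real.norm_of_nonneg hX0.le] at this
      exact (le_abs_self _).trans this
    have hp1 : ε * X ≤ p := by linarith [hp'.1]
    have hp2 : (p : ℝ) ≤ 3 / 2 * X := by linarith [hp'.2]
    have h5 : (2 * (p : ℝ) + 1) * (Real.exp (-(a * √(2 * X - p))) / (2 * X - p) ^ 2) +
        Real.exp (-(a * √p)) ≤ 17 * Real.exp (-(b * √X)) :=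
      aliasing_add_truncation_le ha.le hε0.le hε2 hX1 hp1 hp2
    have h6 : 1 ≤ (π * X) ^ 2 := by
      have : 1 ≤ π * X := one_le_mul_of_one_le_of_one_le (by linarith [Real.pi_gt_three]) hX1
      exact one_le_pow₀ this
    have hC₁0 : 0 ≤ C₁ := by positivity
    have hC₂0 : 0 ≤ C₂ := by positivity
    calc _ ≤ B * K * Z / (2 * π) * (17 * Real.exp (-(b * √X))) :=
          (hlarge (by linarith)).trans (by gcongr)
      _ = C₁ * 1 * Real.exp (-(b * √X)) := by rw [hC₁]; ring
      _ ≤ (C₁ + C₂ + 1) * (π * X) ^ 2 * R := by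
        gcongr
        linarith

end AdaptiveMollifier

theorem theorem3p2 (c : ℝ) (hc : 0 < c) (β₀ : ℝ) (hβ₀ : 1 < β₀) (δ : ℝ) (hδ : 0 < δ)
    (ω : ℝ → ℝ) (hω_mono : Monotone ω) (hω : ω =o[atTop] (fun t : ℝ => t)) :
    ∃ C η : ℝ → ℝ → ℝ, (∀ M r : ℝ, 0 < M → 0 < r → 0 < C M r ∧ 0 < η M r) ∧
      ∀ f : ℝ → ℂ, AdaptiveMollifier.IsPeriodicPiecewiseAnalytic f →
        (∃ M r : ℝ, 0 < M ∧ 0 < r ∧ ∀ x : ℝ, AdaptiveMollifier.LocalAnalyticBound f x M r) ∧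
        ∀ M r : ℝ, 0 < M → 0 < r →
          ∀ x : ℝ, AdaptiveMollifier.LocalAnalyticBound f x M r →
          ∀ β : ℝ, β₀ ≤ β → β < 1.764 → β * Real.log β < 1 →
          ∀ N : ℕ, δ ≤ AdaptiveMollifier.edgeDist f x * N →
          ∀ p : ℕ, |(p : ℝ) - β * Real.log β * AdaptiveMollifier.theta f x * N| ≤
              ω (AdaptiveMollifier.theta f x * N) →
            ‖AdaptiveMollifier.discreteConv c p (AdaptiveMollifier.theta f x) N f x - f x‖ ≤
              C M r * (AdaptiveMollifier.edgeDist f x * N) ^ 2 *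
                (β / Real.exp 1) ^
                  (2 * Real.sqrt (β * η M r * AdaptiveMollifier.theta f x * N)) := by
  choose! C η hpos hη hbound using fun M r (h : 0 < M ∧ 0 < r) =>
    AdaptiveMollifier.exists_uniform_constants hc hβ₀ hδ hω_mono hω h.1 h.2
  exact ⟨C, η, fun M r hM hr => ⟨hpos M r ⟨hM, hr⟩, hη M r ⟨hM, hr⟩⟩, fun f hf =>
    ⟨AdaptiveMollifier.exists_localAnalyticBound hf, fun M r hM hr x hx =>
      hbound M r ⟨hM, hr⟩ f hf.1 x hx⟩⟩
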